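/- Let $N\ge 1$ and let $\mathcal A=\{\alpha_1,\dots,\alpha_N,\beta_1,\dots,\beta_N\}$. Take any unrooted infinite directed tree in which every vertex receives exactly one edge and emits exactly $N$ edges, and label the $N$ edges leaving each vertex by $\alpha_1,\dots,\alpha_N$, each label being used once. For each $i$ and each edge $e$ labelled $\alpha_i$ add an edge from $r(e)$ to $s(e)$ labelled $\beta_i$. Let $(E_N,\mathcal L_N)$ be the resulting labelled graph, which presents the Dyck shift $D_N$. For a set $A$ of vertices and a labelled path (the label of a finite path of length $\ge 1$) $\alpha$, let $r(A,\alpha)$ be the set of ranges of the paths labelled $\alpha$ with source in $A$, let $r(\alpha)=r(E_N^0,\alpha)$, and let $L^1_A$ be the set of labels of the edges with source in $A$. Let $\mathcal E_N^{0,-}$ be the smallest collection of subsets of $E_N^0$ that contains $\emptyset$ and $r(\alpha)$ for all labelled paths $\alpha$ and is closed under $A\mapsto r(A,\alpha)$ for all labelled paths $\alpha$ and under finite intersections and unions. Let $C^*(E_N,\mathcal L_N,\mathcal E_N^{0,-})$ be the universal $C^*$-algebra generated by projections $\{p_A: A\in\mathcal E_N^{0,-}\}$ and partial isometries $\{s_a: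 a\in\mathcal A\}$ such that, for all $A,B\in\mathcal E_N^{0,-}$ and $a,b\in\mathcal A$: 1. $p_\emptyset=0$, $p_Ap_B=p_{A\cap B}$ and $p_{A\cup B}=p_A+p_B-p_{A\cap B}$; 2. $p_As_a=s_ap_{r(A,a)}$; 3. $s_a^*s_a=p_{r(a)}$, and $s_a^*s_b=0$ if $a\ne b$; 4. $p_A=\sum_{a\in L^1_A}s_ap_{r(A,a)}s_a^*$. Then $C^*(E_N,\mathcal L_N,\mathcal E_N^{0,-})$ is simple (it is nonzero and its only closed two-sided ideals are $0$ and itself) and purely infinite (every nonzero hereditary $C^*$-subalgebra contains an infinite projection, that is, one Murray–von Neumann equivalent to a proper subprojection of itself). -/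

import Mathlib

open scoped ENNReal

universe u v w

/-! ## Simple and purely infinite C*-algebras -/

/-- A C*-algebra is simple if it is nonzero and its only closed two-sided ideals are `0` and the
whole algebra. -/
def IsSimpleCStar (A : Type u) [NonUnitalCStarAlgebra A] : Prop :=
  Nontrivial A ∧ ∀ I : TwoSidedIdeal A, IsClosed (I : Set A) → I = ⊥ ∨ I = ⊤

/-- A projection `p` is infinite if it is Murray-von Neumann equivalent to a proper
subprojection of itself: there is `x` with `x* x = p` and `x x* ≤ p`, `x x* ≠ p`. For projections
`q ≤ p` means `p q = q`. -/
def IsInfiniteProjection {A : Type u} [NonUnitalCStarAlgebra A] (p : A) : Prop :=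
  IsStarProjection p ∧
    ∃ x : A, star x * x = p ∧ p * (x * star x) = x * star x ∧ x * star x ≠ p

/-- A hereditary C*-subalgebra: a norm closed *-subalgebra `H` such that `0 ≤ b ≤ a` and `a ∈ H`
imply `b ∈ H`. The positive elements of a C*-algebra are the elements `c* c`. -/
def IsHereditaryCStarSubalgebra {A : Type u} [NonUnitalCStarAlgebra A]
    (H : NonUnitalStarSubalgebra ℂ A) : Prop :=
  IsClosed (H : Set A) ∧
    ∀ a ∈ H, ∀ b : A, (∃ c : A, b = star c * c) → (∃ d : A, a - b = star d * d) → b ∈ H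

/-- A (simple) C*-algebra is purely infinite if every nonzero hereditary C*-subalgebra contains
an infinite projection. -/
def IsPurelyInfiniteCStar (A : Type u) [NonUnitalCStarAlgebra A] : Prop :=
  ∀ H : NonUnitalStarSubalgebra ℂ A, IsHereditaryCStarSubalgebra H → H ≠ ⊥ →
    ∃ p ∈ H, IsInfiniteProjection p

/-! ## Labelled graphs -/

/-- A directed graph with vertex set `V`, edge set `E`, source and range maps `s` and `r`,
together with a labelling of its edges by letters from `𝒜`. -/
structure LabelledGraph (V : Type u) (E : Type w) (𝒜 : Type v) where
  /-- the source of an edge -/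
  s : E → V
  /-- the range of an edge -/
  r : E → V
  /-- the label of an edge -/
  label : E → 𝒜

namespace LabelledGraph

variable {V : Type u} {E : Type w} {𝒜 : Type v} (G : LabelledGraph V E 𝒜)

/-- `G.HasPath x α y`: there is a path `e₁ … eₙ` of length `n ≥ 1` from `x` to `y`, the range of
each edge being the source of the next one, with label `α = label e₁ … label eₙ`. -/
inductive HasPath : V → List 𝒜 → V → Prop
  | single (e : E) : HasPath (G.s e) [G.label e] (G.r e)
  | cons (e : E) {α : List 𝒜} {y : V} (h : HasPath (G.r e) α y) :
      HasPath (G.s e) (G.label e :: α) y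

/-- The set of labelled paths of length at least one. -/
def labelledPaths : Set (List 𝒜) := {α | ∃ x y, G.HasPath x α y}

/-- The relative range `r(A, α)`: the ranges of the paths labelled `α` with source in `A`. -/
def relRange (A : Set V) (α : List 𝒜) : Set V := {y | ∃ x ∈ A, G.HasPath x α y}

/-- The range `r(α)` of a labelled path. -/
def range (α : List 𝒜) : Set V := G.relRange Set.univ α

/-- The set `L¹_A` of the labels of the edges with source in `A`. -/
def emitted (A : Set V) : Set 𝒜 := {a | ∃ e : E, G.s e ∈ A ∧ G.label e = a}

/-- A collection of sets of vertices is accommodating if it contains the ranges of all labelled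
paths and is closed under relative ranges, finite intersections and finite unions (the empty
union `∅` included). -/
structure IsAccommodating (B : Set (Set V)) : Prop where
  empty_mem : ∅ ∈ B
  range_mem : ∀ α ∈ G.labelledPaths, G.range α ∈ B
  relRange_mem : ∀ A ∈ B, ∀ α ∈ G.labelledPaths, G.relRange A α ∈ B
  inter_mem : ∀ A ∈ B, ∀ A' ∈ B, A ∩ A' ∈ B
  union_mem : ∀ A ∈ B, ∀ A' ∈ B, A ∪ A' ∈ B

/-- The smallest accommodating collection `𝓔^{0,-}`. -/
def smallestAcc : Set (Set V) := {A | ∀ B : Set (Set V), G.IsAccommodating B → A ∈ B}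

variable {G}

theorem empty_mem : ∅ ∈ G.smallestAcc := fun _ hB => hB.empty_mem

theorem inter_mem {A A' : Set V} (hA : A ∈ G.smallestAcc) (hA' : A' ∈ G.smallestAcc) :
    A ∩ A' ∈ G.smallestAcc :=
  fun B hB => hB.inter_mem A (hA B hB) A' (hA' B hB)

theorem union_mem {A A' : Set V} (hA : A ∈ G.smallestAcc) (hA' : A' ∈ G.smallestAcc) :
    A ∪ A' ∈ G.smallestAcc :=
  fun B hB => hB.union_mem A (hA B hB) A' (hA' B hB)

theorem relRange_eq_empty {A : Set V} {α : List 𝒜} (hα : α ∉ G.labelledPaths) :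
    G.relRange A α = ∅ := by
  ext y
  simp only [relRange, Set.mem_ofPred_eq, Set.mem_empty_iff_false, iff_false]
  rintro ⟨x, -, hx⟩
  exact hα ⟨x, y, hx⟩

theorem relRange_mem {A : Set V} (hA : A ∈ G.smallestAcc) (α : List 𝒜) :
    G.relRange A α ∈ G.smallestAcc := by
  by_cases hα : α ∈ G.labelledPaths
  · exact fun B hB => hB.relRange_mem A (hA B hB) α hα
  · rw [relRange_eq_empty hα]
    exact empty_mem

theorem range_mem (α : List 𝒜) : G.range α ∈ G.smallestAcc := by
  by_cases hα : α ∈ G.labelledPaths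
  · exact fun B hB => hB.range_mem α hα
  · rw [range, relRange_eq_empty hα]
    exact empty_mem

variable (G)

/-! ## The C*-algebra of a labelled space -/

/-- A representation of the labelled space `(E, 𝓛, 𝓔^{0,-})` in a C*-algebra. The last relation is
imposed for the sets `A` that emit finitely many labels, the case in which the sum is defined
(all sets `A`, if the alphabet is finite). -/
structure Representation (B : Type*) [NonUnitalCStarAlgebra B] where
  /-- the projections -/
  p : G.smallestAcc → B
  /-- the partial isometries -/
  s : 𝒜 → B
  isStarProjection_p : ∀ A, IsStarProjection (p A)
  partialIsometry_s : ∀ a, s a * star (s a) * s a = s a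
  p_empty : p ⟨∅, empty_mem⟩ = 0
  p_inter : ∀ A A' : G.smallestAcc, p A * p A' = p ⟨A ∩ A', inter_mem A.2 A'.2⟩
  p_union : ∀ A A' : G.smallestAcc,
    p ⟨A ∪ A', union_mem A.2 A'.2⟩ = p A + p A' - p ⟨A ∩ A', inter_mem A.2 A'.2⟩
  p_mul_s : ∀ (A : G.smallestAcc) (a : 𝒜),
    p A * s a = s a * p ⟨G.relRange A [a], relRange_mem A.2 [a]⟩
  star_s_mul_s : ∀ a, star (s a) * s a = p ⟨G.range [a], range_mem [a]⟩
  star_s_mul_s_of_ne : ∀ a b, a ≠ b → star (s a) * s b = 0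
  p_eq_sum : ∀ (A : G.smallestAcc) (hA : (G.emitted A).Finite),
    p A = ∑ a ∈ hA.toFinset,
      s a * p ⟨G.relRange A [a], relRange_mem A.2 [a]⟩ * star (s a)

/-- The index type of the family of all representations of the labelled space. The C*-algebra
generated by a representation has a dense *-subalgebra generated by a family indexed by letters
and sets of vertices, so the C*-algebras in this universe represent all of them up to
isomorphism. -/
structure RepIndex where
  /-- the C*-algebra in which the labelled space is represented -/
  alg : Type (max u v)
  [inst : NonUnitalCStarAlgebra alg]
  /-- the representation -/
  rep : G.Representation alg

instance (i : G.RepIndex) : NonUnitalCStarAlgebra i.alg := i.inst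

theorem norm_le_one_of_isStarProjection {B : Type*} [NonUnitalCStarAlgebra B] {p : B}
    (hp : IsStarProjection p) : ‖p‖ ≤ 1 := by
  have h : ‖p‖ = ‖p‖ * ‖p‖ := by
    have := CStarRing.norm_star_mul_self (x := p)
    rwa [hp.isSelfAdjoint.star_eq, hp.isIdempotentElem.eq] at this
  nlinarith [norm_nonneg p, sq_nonneg (‖p‖ - 1)]

theorem Representation.norm_s_le_one {B : Type*} [NonUnitalCStarAlgebra B]
    (ρ : G.Representation B) (a : 𝒜) : ‖ρ.s a‖ ≤ 1 := by
  have h1 := CStarRing.norm_star_mul_self (x := ρ.s a)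
  rw [ρ.star_s_mul_s] at h1
  have h2 := norm_le_one_of_isStarProjection
    (ρ.isStarProjection_p ⟨G.range [a], range_mem [a]⟩)
  nlinarith [norm_nonneg (ρ.s a)]

/-- The projection `p_A` in the product of all representations. -/
def prodP (A : G.smallestAcc) : lp (fun i : G.RepIndex => i.alg) ∞ :=
  ⟨fun i => i.rep.p A, memℓp_infty ⟨1, by
    rintro _ ⟨i, rfl⟩
    exact norm_le_one_of_isStarProjection (i.rep.isStarProjection_p A)⟩⟩

/-- The partial isometry `s_a` in the product of all representations. -/
def prodS (a : 𝒜) : lp (fun i : G.RepIndex => i.alg) ∞ :=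
  ⟨fun i => i.rep.s a, memℓp_infty ⟨1, by
    rintro _ ⟨i, rfl⟩
    exact i.rep.norm_s_le_one G a⟩⟩

/-- The C*-subalgebra generated by all `p_A` and `s_a` in the product of all representations. -/
noncomputable def cstarSubalgebra :
    NonUnitalStarSubalgebra ℂ (lp (fun i : G.RepIndex => i.alg) ∞) :=
  (NonUnitalStarAlgebra.adjoin ℂ
    (Set.range G.prodP ∪ Set.range G.prodS)).topologicalClosure

/-- The C*-algebra `C*(E, 𝓛, 𝓔^{0,-})` of the labelled space: the universal C*-algebra generated by
a representation, realized as the C*-algebra generated by the product of all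
representations. -/
def CStar : Type (max u v + 1) := G.cstarSubalgebra

noncomputable instance : NonUnitalCStarAlgebra G.CStar :=
  NonUnitalStarSubalgebra.nonUnitalCStarAlgebra G.cstarSubalgebra
    (h_closed := NonUnitalStarSubalgebra.isClosed_topologicalClosure _)

/-- The *-homomorphism from `G.CStar` to the algebra of the `i`-th representation: the restriction
of the coordinate projection of the product. -/
noncomputable def evalRep (i : G.RepIndex) : G.CStar →⋆ₙₐ[ℂ] i.alg where
  toFun x := (Subtype.val x : lp (fun i : G.RepIndex => i.alg) ∞) i
  map_smul' _ _ := rfl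
  map_zero' := rfl
  map_add' _ _ := rfl
  map_mul' _ _ := rfl
  map_star' _ := rfl

variable {G} in
theorem CStar.ext {x y : G.CStar} (h : ∀ i, G.evalRep i x = G.evalRep i y) : x = y :=
  Subtype.ext (lp.ext (funext h))

/-- The generator `p_A` of `G.CStar`. -/
noncomputable def genP (A : G.smallestAcc) : G.CStar :=
  ⟨G.prodP A, NonUnitalStarSubalgebra.le_topologicalClosure _
    (NonUnitalStarAlgebra.subset_adjoin ℂ _ (Or.inl ⟨A, rfl⟩))⟩

/-- The generator `s_a` of `G.CStar`. -/
noncomputable def genS (a : 𝒜) : G.CStar :=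
  ⟨G.prodS a, NonUnitalStarSubalgebra.le_topologicalClosure _
    (NonUnitalStarAlgebra.subset_adjoin ℂ _ (Or.inr ⟨a, rfl⟩))⟩

theorem evalRep_genP (i : G.RepIndex) (A : G.smallestAcc) :
    G.evalRep i (G.genP A) = i.rep.p A := rfl

theorem evalRep_genS (i : G.RepIndex) (a : 𝒜) :
    G.evalRep i (G.genS a) = i.rep.s a := rfl

/-- The universal representation, by the generators of `G.CStar`. -/
noncomputable def universalRep : G.Representation G.CStar where
  p := G.genP
  s := G.genS
  isStarProjection_p A :=
    ⟨CStar.ext fun i => by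
        rw [map_mul, evalRep_genP, (i.rep.isStarProjection_p A).isIdempotentElem.eq],
      CStar.ext fun i => by
        rw [map_star, evalRep_genP, (i.rep.isStarProjection_p A).isSelfAdjoint.star_eq]⟩
  partialIsometry_s a := CStar.ext fun i => by
    simp only [map_mul, map_star, evalRep_genS, i.rep.partialIsometry_s]
  p_empty := CStar.ext fun i => by rw [map_zero, evalRep_genP, i.rep.p_empty]
  p_inter A A' := CStar.ext fun i => by
    simp only [map_mul, evalRep_genP, i.rep.p_inter]
  p_union A A' := CStar.ext fun i => by
    simp only [map_sub, map_add, evalRep_genP, i.rep.p_union]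
  p_mul_s A a := CStar.ext fun i => by
    simp only [map_mul, evalRep_genP, evalRep_genS, i.rep.p_mul_s]
  star_s_mul_s a := CStar.ext fun i => by
    simp only [map_mul, map_star, evalRep_genP, evalRep_genS, i.rep.star_s_mul_s]
  star_s_mul_s_of_ne a b h := CStar.ext fun i => by
    simp only [map_mul, map_star, map_zero, evalRep_genS, i.rep.star_s_mul_s_of_ne a b h]
  p_eq_sum A hA := CStar.ext fun i => by
    simp only [map_sum, map_mul, map_star, evalRep_genP, evalRep_genS]
    exact i.rep.p_eq_sum A hA

/-- The universal property of `G.CStar`. -/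
theorem existsUnique_lift {B : Type (max u v)} [NonUnitalCStarAlgebra B]
    (ρ : G.Representation B) :
    ∃! φ : G.CStar →⋆ₙₐ[ℂ] B,
      (∀ A, φ (G.universalRep.p A) = ρ.p A) ∧ ∀ a, φ (G.universalRep.s a) = ρ.s a := by
  refine ⟨G.evalRep ⟨B, ρ⟩, ⟨fun A => rfl, fun a => rfl⟩, ?_⟩
  rintro φ ⟨hp, hs⟩
  have key : ∀ (x : lp (fun i : G.RepIndex => i.alg) ∞)
      (hx : x ∈ NonUnitalStarAlgebra.adjoin ℂ (Set.range G.prodP ∪ Set.range G.prodS)),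
      φ (show G.CStar from ⟨x, NonUnitalStarSubalgebra.le_topologicalClosure _ hx⟩) =
        G.evalRep ⟨B, ρ⟩ (show G.CStar from
          ⟨x, NonUnitalStarSubalgebra.le_topologicalClosure _ hx⟩) := by
    intro x hx
    induction hx using NonUnitalStarAlgebra.adjoin_induction with
    | mem x hx =>
      rcases hx with ⟨A, rfl⟩ | ⟨a, rfl⟩
      · exact hp A
      · exact hs a
    | add x y hx hy ihx ihy =>
      exact (map_add φ _ _).trans ((congrArg₂ (· + ·) ihx ihy).trans
        (map_add (G.evalRep ⟨B, ρ⟩) _ _).symm)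
    | zero => exact (map_zero φ).trans (map_zero (G.evalRep ⟨B, ρ⟩)).symm
    | mul x y hx hy ihx ihy =>
      exact (map_mul φ _ _).trans ((congrArg₂ (· * ·) ihx ihy).trans
        (map_mul (G.evalRep ⟨B, ρ⟩) _ _).symm)
    | smul r x hx ihx =>
      exact (map_smul φ r _).trans ((congrArg (r • ·) ihx).trans
        (map_smul (G.evalRep ⟨B, ρ⟩) r _).symm)
    | star x hx ihx =>
      exact (map_star φ _).trans ((congrArg star ihx).trans
        (map_star (G.evalRep ⟨B, ρ⟩) _).symm)
  have hdense : Dense {x : G.CStar | (Subtype.val x : lp (fun i : G.RepIndex => i.alg) ∞) ∈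
      NonUnitalStarAlgebra.adjoin ℂ (Set.range G.prodP ∪ Set.range G.prodS)} := by
    intro x
    refine closure_subtype.2 (closure_mono ?_ x.2)
    intro y hy
    exact ⟨⟨y, NonUnitalStarSubalgebra.le_topologicalClosure _ hy⟩, hy, rfl⟩
  have hcont : ∀ ψ : G.CStar →⋆ₙₐ[ℂ] B, Continuous ψ := fun ψ =>
    AddMonoidHomClass.continuous_of_bound ψ 1 fun x => by
      rw [one_mul]
      exact NonUnitalStarAlgHom.norm_apply_le ψ x
  refine DFunLike.coe_injective
    (Continuous.ext_on hdense (hcont φ) (hcont (G.evalRep ⟨B, ρ⟩)) ?_)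
  exact fun x hx => key x.1 hx

end LabelledGraph

/-! ## The labelled graph presenting the Dyck shift -/

/-- An `N`-ary tree with vertex set `V`: an unrooted tree whose edges are directed (each in exactly
one direction) so that every vertex receives one edge and emits `N` edges; the `N` branches from a
vertex `x` lead to the vertices `child x i`, listed from left to right. -/
structure NaryTree (N : ℕ) (V : Type u) where
  /-- the underlying undirected tree -/
  tree : SimpleGraph V
  isTree : tree.IsTree
  /-- the range of the `i`-th branch from a vertex -/
  child : V → Fin N → V
  child_injective : ∀ x, Function.Injective (child x)
  adj_iff : ∀ x y, tree.Adj x y ↔ (∃ i, child x i = y) ∨ ∃ i, child y i = x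
  asymm : ∀ x y i j, child x i = y → child y j ≠ x
  existsUnique_parent : ∀ y, ∃! x, ∃ i, child x i = y

/-- The alphabet of the Dyck shift: opening brackets `α₁, …, α_N` and closing brackets
`β₁, …, β_N`. -/
inductive DyckLetter (N : ℕ) : Type
  | opening (i : Fin N)
  | closing (i : Fin N)

/-- The labelled graph built from an `N`-ary tree. For each vertex `x` and each `i` there is the
branch `Sum.inl (x, i)` from `x` to `child x i`, with label `α_i`, and the reversed edge
`Sum.inr (x, i)` from `child x i` to `x`, with label `β_i`. -/
def NaryTree.dyckGraph {N : ℕ} {V : Type u} (T : NaryTree N V) :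
    LabelledGraph V ((V × Fin N) ⊕ (V × Fin N)) (DyckLetter N) where
  s := Sum.elim (fun e => e.1) (fun e => T.child e.1 e.2)
  r := Sum.elim (fun e => T.child e.1 e.2) (fun e => e.1)
  label := Sum.elim (fun e => DyckLetter.opening e.2) (fun e => DyckLetter.closing e.2)

/-!
The letters `α₁, …, α_N` and `β₁, …, β_N` act on the vertices of the tree as pushes and pops. The
sets in the accommodating collection are finite unions of cylinder sets: the set `V_w` consists of
the vertices whose backward path starts with the branches `w`, and every given set of the collection
contains or misses each sufficiently long cylinder (`NaryTree.eventually_cylinder_inter`). Popping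
the brackets of `w` leads from `V_w` to the set of all vertices, so each cylinder projection is
compressed to the unit `p_V` by a product of the generators
(`NaryTree.star_word_mul_p_cylinder_mul_word`).

Everything follows from one assertion: for each nonzero `h` in the universal algebra there is `x` with
`x* (h* h) x = 1`. It gives simplicity at once. It also shows that every nonzero hereditary subalgebra
contains a projection equivalent to `1`, and `1` is infinite because `s_β` is a nonunitary isometry.

The elements `s_μ p_A s_ν*` span a dense *-subalgebra. Those with `|μ| = |ν|` span the algebraic core
and are fixed by the gauge action; the others are off-diagonal. Averages of the gauge action over
finer and finer roots of unity remove off-diagonal elements, do not increase norms, and do not make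
the positive element `h* h` arbitrarily small, since a fixed proportion of the roots of unity moves
it only a little (`exists_le_norm_gaugeAverage`). Hence `h* h` is close to `b + x` with `b` in the core
of comparatively large norm and `x` off-diagonal. The core part is a finite direct sum of scalar
matrices with respect to the matrix units `s_μ p_w s_ν*`, where `p_w` are long cylinder projections,
and an eigenvector compresses it to a multiple `θ p_w` with `|θ| ≥ ‖b‖`
(`exists_eigenvector_compression`). A further compression by the word that pops `w`, followed by the
aperiodic word `αᵐ βᵐ`, turns `p_w` into `1` and annihilates `x`
(`NaryTree.exists_isometry_compression`).

The argument presupposes that the universal algebra is nonzero, which is seen from its representation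
on the square summable functions on the space of infinite paths of the graph
(`NaryTree.pathRepresentation`).
-/

/-! ### Vertex sets of the Dyck graph -/

namespace LabelledGraph

variable {V : Type u} {E : Type w} {𝒜 : Type v} (G : LabelledGraph V E 𝒜)

variable {G} in
theorem HasPath.ne_nil {x y : V} {α : List 𝒜} (h : G.HasPath x α y) : α ≠ [] := by
  cases h <;> simp

theorem hasPath_singleton {x y : V} {a : 𝒜} :
    G.HasPath x [a] y ↔ ∃ e, G.s e = x ∧ G.label e = a ∧ G.r e = y := by
  constructor
  · intro h
    cases h with
    | single e => exact ⟨e, rfl, rfl, rfl⟩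
    | cons e h => exact absurd rfl h.ne_nil
  · rintro ⟨e, rfl, rfl, rfl⟩
    exact .single e

theorem relRange_cons (A : Set V) (a : 𝒜) {α : List 𝒜} (hα : α ≠ []) :
    G.relRange A (a :: α) = G.relRange (G.relRange A [a]) α := by
  ext y
  simp only [relRange, Set.mem_ofPred_eq, hasPath_singleton]
  constructor
  · rintro ⟨x, hx, h⟩
    cases h with
    | single e => exact absurd rfl hα
    | cons e h => exact ⟨_, ⟨_, hx, e, rfl, rfl, rfl⟩, h⟩
  · rintro ⟨_, ⟨_, hx, e, rfl, rfl, rfl⟩, h⟩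
    exact ⟨_, hx, .cons e h⟩

/-- The relative range with the empty word allowed, `r(A, ∅) = A`; unlike `relRange` it is
multiplicative in the word without exception. -/
def wordRange (A : Set V) (α : List 𝒜) : Set V := α.foldl (fun B a => G.relRange B [a]) A

@[simp] theorem wordRange_nil (A : Set V) : G.wordRange A [] = A := rfl

@[simp] theorem wordRange_cons (A : Set V) (a : 𝒜) (α : List 𝒜) :
    G.wordRange A (a :: α) = G.wordRange (G.relRange A [a]) α := rfl

theorem wordRange_append (A : Set V) (α β : List 𝒜) :
    G.wordRange A (α ++ β) = G.wordRange (G.wordRange A α) β := List.foldl_append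

theorem relRange_eq_wordRange (A : Set V) {α : List 𝒜} (hα : α ≠ []) :
    G.relRange A α = G.wordRange A α := by
  induction α generalizing A with
  | nil => exact absurd rfl hα
  | cons a α ih =>
    by_cases h : α = []
    · subst h; rfl
    · rw [relRange_cons _ _ _ h, ih _ h, wordRange_cons]

theorem wordRange_mem {A : Set V} (hA : A ∈ G.smallestAcc) (α : List 𝒜) :
    G.wordRange A α ∈ G.smallestAcc := by
  induction α generalizing A with
  | nil => exact hA
  | cons a α ih => exact ih (relRange_mem hA [a])

theorem relRange_eq_empty_of_notMem_emitted {A : Set V} {a : 𝒜} (h : a ∉ G.emitted A) :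
    G.relRange A [a] = ∅ := by
  ext y
  simp only [relRange, hasPath_singleton, Set.mem_ofPred_eq, Set.mem_empty_iff_false, iff_false]
  rintro ⟨x, hx, e, rfl, rfl, rfl⟩
  exact h ⟨e, hx, rfl⟩

end LabelledGraph

open LabelledGraph

namespace NaryTree

variable {N : ℕ} {V : Type u} (T : NaryTree N V)

/-- The source of the unique branch into a vertex. -/
noncomputable def parent (y : V) : V := (T.existsUnique_parent y).choose

/-- The index of the unique branch into a vertex. -/
noncomputable def branch (y : V) : Fin N := (T.existsUnique_parent y).choose_spec.1.choose

@[simp] theorem child_parent_branch (y : V) : T.child (T.parent y) (T.branch y) = y :=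
  (T.existsUnique_parent y).choose_spec.1.choose_spec

@[simp] theorem parent_child (x : V) (i : Fin N) : T.parent (T.child x i) = x :=
  (T.existsUnique_parent (T.child x i)).unique ⟨_, T.child_parent_branch _⟩ ⟨i, rfl⟩

@[simp] theorem branch_child (x : V) (i : Fin N) : T.branch (T.child x i) = i :=
  T.child_injective x (by simpa using T.child_parent_branch (T.child x i))

theorem relRange_opening (A : Set V) (i : Fin N) :
    T.dyckGraph.relRange A [.opening i] = {y | T.branch y = i ∧ T.parent y ∈ A} := by
  ext y
  simp only [relRange, Set.mem_ofPred_eq, hasPath_singleton]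
  constructor
  · rintro ⟨x, hx, ⟨x', j⟩ | ⟨x', j⟩, rfl, h, rfl⟩
    · cases h
      exact ⟨T.branch_child _ _, by simpa [dyckGraph] using hx⟩
    · cases h
  · rintro ⟨rfl, h⟩
    exact ⟨_, h, .inl (T.parent y, T.branch y), rfl, rfl, T.child_parent_branch y⟩

theorem relRange_closing (A : Set V) (i : Fin N) :
    T.dyckGraph.relRange A [.closing i] = {y | T.child y i ∈ A} := by
  ext y
  simp only [relRange, Set.mem_ofPred_eq, hasPath_singleton]
  constructor
  · rintro ⟨x, hx, ⟨x', j⟩ | ⟨x', j⟩, rfl, h, rfl⟩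
    · cases h
    · cases h
      exact hx
  · exact fun h => ⟨_, h, .inr (y, i), rfl, rfl, rfl⟩

theorem univ_mem (hN : 1 ≤ N) : Set.univ ∈ T.dyckGraph.smallestAcc := by
  have h := range_mem (G := T.dyckGraph) [DyckLetter.closing ⟨0, hN⟩]
  rw [range, relRange_closing] at h
  simpa using h

theorem wordRange_opening_closing (A : Set V) (i : Fin N) (m : ℕ) :
    T.dyckGraph.wordRange A (List.replicate m (.opening i) ++ List.replicate m (.closing i)) = A := by
  induction m generalizing A with
  | zero => rfl
  | succ m ih =>
    rw [List.replicate_succ, List.replicate_succ', List.cons_append, wordRange_cons,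
      ← List.append_assoc, wordRange_append, ih, wordRange_cons, wordRange_nil, relRange_opening,
      relRange_closing]
    simp

/-- The vertices at which the last `L` branches of the backward path are given by `w`, the
nearest branch being `w 0`. -/
def cylinder {L : ℕ} (w : Fin L → Fin N) : Set V :=
  {x | ∀ j : Fin L, T.branch (T.parent^[j] x) = w j}

theorem cylinder_zero (w : Fin 0 → Fin N) : T.cylinder w = Set.univ := by
  simp [cylinder]

theorem mem_cylinder_cons {L : ℕ} {w : Fin L → Fin N} {i : Fin N} {x : V} :
    x ∈ T.cylinder (Fin.cons i w : Fin (L + 1) → Fin N) ↔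
      T.branch x = i ∧ T.parent x ∈ T.cylinder w := by
  simp [cylinder, Fin.forall_fin_succ]

theorem relRange_opening_cylinder {L : ℕ} (w : Fin L → Fin N) (i : Fin N) :
    T.dyckGraph.relRange (T.cylinder w) [.opening i] =
      T.cylinder (Fin.cons i w : Fin (L + 1) → Fin N) := by
  ext x
  simp [relRange_opening, mem_cylinder_cons]

theorem relRange_closing_cylinder {L : ℕ} (w : Fin L → Fin N) (i : Fin N) :
    T.dyckGraph.relRange (T.cylinder (Fin.cons i w : Fin (L + 1) → Fin N)) [.closing i] =
      T.cylinder w := by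
  ext x
  simp [relRange_closing, mem_cylinder_cons]

theorem cylinder_mem (hN : 1 ≤ N) {L : ℕ} (w : Fin L → Fin N) :
    T.cylinder w ∈ T.dyckGraph.smallestAcc := by
  induction L with
  | zero => rw [cylinder_zero]; exact T.univ_mem hN
  | succ L ih =>
    rw [← Fin.cons_self_tail w, ← relRange_opening_cylinder]
    exact relRange_mem (ih _) _

/-- Closing the last `L` brackets leads from a cylinder set to the set of all vertices. -/
theorem wordRange_cylinder {L : ℕ} (w : Fin L → Fin N) :
    T.dyckGraph.wordRange (T.cylinder w) (List.ofFn fun j => DyckLetter.closing (w j)) =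
      Set.univ := by
  induction L with
  | zero => simp [cylinder_zero]
  | succ L ih =>
    rw [List.ofFn_succ, wordRange_cons]
    conv_lhs => rw [← Fin.cons_self_tail w]
    simp only [Fin.cons_zero, Fin.cons_succ]
    rw [relRange_closing_cylinder]
    exact ih (Fin.tail w)

theorem cylinder_disjoint {L : ℕ} {w w' : Fin L → Fin N} (h : w ≠ w') :
    T.cylinder w ∩ T.cylinder w' = ∅ := by
  ext x
  simp only [Set.mem_inter_iff, Set.mem_empty_iff_false, iff_false, not_and]
  exact fun hx hx' => h (funext fun j => (hx j).symm.trans (hx' j))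

theorem iUnion_cylinder (L : ℕ) : ⋃ w : Fin L → Fin N, T.cylinder w = Set.univ :=
  Set.eq_univ_of_forall fun x => Set.mem_iUnion.2 ⟨fun j => T.branch (T.parent^[j] x), fun _ => rfl⟩

/-- `A` is a union of cylinder sets of length `L`: membership in `A` is determined by the last `L`
branches. -/
def IsDetermined (L : ℕ) (A : Set V) : Prop :=
  ∀ x y, (∀ j < L, T.branch (T.parent^[j] x) = T.branch (T.parent^[j] y)) → x ∈ A → y ∈ A

variable {T} in
theorem IsDetermined.mono {L L' : ℕ} {A : Set V} (h : T.IsDetermined L A) (hL : L ≤ L') :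
    T.IsDetermined L' A :=
  fun x y hxy => h x y fun j hj => hxy j (hj.trans_le hL)

variable {T} in
theorem IsDetermined.relRange {L : ℕ} {A : Set V} (h : T.IsDetermined L A) (a : DyckLetter N) :
    T.IsDetermined (L + 1) (T.dyckGraph.relRange A [a]) := by
  intro x y hxy
  cases a with
  | opening i =>
    rw [relRange_opening]
    rintro ⟨rfl, hx⟩
    exact ⟨(hxy 0 (by omega)).symm, h _ _ (fun j hj => hxy (j + 1) (by omega)) hx⟩
  | closing i =>
    rw [relRange_closing]
    refine h _ _ fun j hj => ?_
    cases j with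
    | zero => simp
    | succ j => simpa using hxy j (by omega)

theorem isAccommodating_isDetermined :
    T.dyckGraph.IsAccommodating {A | ∃ L, T.IsDetermined L A} := by
  have hr : ∀ α : List (DyckLetter N), ∀ A : Set V, (∃ L, T.IsDetermined L A) →
      ∃ L, T.IsDetermined L (T.dyckGraph.relRange A α) := by
    intro α
    by_cases hα : α = []
    · rintro A -
      refine ⟨0, fun x y _ hx => ?_⟩
      obtain ⟨_, -, h⟩ := hx
      exact absurd hα h.ne_nil
    · intro A
      rw [relRange_eq_wordRange _ _ hα]
      clear hα
      induction α generalizing A with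
      | nil => exact id
      | cons a α ih =>
        rintro ⟨L, hL⟩
        exact ih _ ⟨L + 1, hL.relRange a⟩
  refine ⟨⟨0, fun _ _ _ h => h⟩, fun α _ => hr α _ ⟨0, fun _ _ _ _ => trivial⟩,
    fun A hA α _ => hr α A hA, ?_, ?_⟩
  · rintro A ⟨L, hL⟩ A' ⟨L', hL'⟩
    exact ⟨max L L', fun x y hxy hx => ⟨hL.mono (le_max_left _ _) x y hxy hx.1,
      hL'.mono (le_max_right _ _) x y hxy hx.2⟩⟩
  · rintro A ⟨L, hL⟩ A' ⟨L', hL'⟩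
    exact ⟨max L L', fun x y hxy hx => hx.imp (hL.mono (le_max_left _ _) x y hxy)
      (hL'.mono (le_max_right _ _) x y hxy)⟩

/-- Long cylinder sets are atoms for each given set of the accommodating collection. -/
theorem eventually_cylinder_inter {A : Set V} (hA : A ∈ T.dyckGraph.smallestAcc) :
    ∀ᶠ L in Filter.atTop, ∀ w : Fin L → Fin N,
      T.cylinder w ∩ A = T.cylinder w ∨ T.cylinder w ∩ A = ∅ := by
  obtain ⟨L, hL⟩ := hA _ T.isAccommodating_isDetermined
  filter_upwards [Filter.eventually_ge_atTop L] with L' hL' w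
  by_cases h : ∃ x ∈ T.cylinder w, x ∈ A
  · obtain ⟨x, hxw, hxA⟩ := h
    refine .inl (Set.inter_eq_left.2 fun y hy => hL.mono hL' x y (fun j hj => ?_) hxA)
    exact (hxw ⟨j, hj⟩).trans (hy ⟨j, hj⟩).symm
  · exact .inr (Set.eq_empty_of_forall_notMem fun x hx => h ⟨x, hx.1, hx.2⟩)

end NaryTree

/-! ### Words in a representation of a labelled space -/

theorem List.IsPrefix.getElem?_eq_some {α : Type*} {l₁ l₂ : List α} (h : l₁ <+: l₂) {i : ℕ} {c : α}
    (hc : l₁[i]? = some c) : l₂[i]? = some c := by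
  obtain ⟨t, rfl⟩ := h
  rw [List.getElem?_append_left (List.getElem?_eq_some_iff.1 hc).1, hc]

namespace LabelledGraph.Representation

variable {V : Type u} {E : Type w} {𝒜 : Type v} {G : LabelledGraph V E 𝒜}
variable {B : Type*} [CStarAlgebra B] (ρ : G.Representation B)

/-- The product `s_μ` of the partial isometries along a word. -/
noncomputable def word (μ : List 𝒜) : B := (μ.map ρ.s).prod

@[simp] theorem word_nil : ρ.word [] = 1 := rfl

@[simp] theorem word_cons (a : 𝒜) (μ : List 𝒜) : ρ.word (a :: μ) = ρ.s a * ρ.word μ := by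
  simp [word]

theorem word_append (μ ν : List 𝒜) : ρ.word (μ ++ ν) = ρ.word μ * ρ.word ν := by
  simp [word]

@[simp] theorem star_p (A : G.smallestAcc) : star (ρ.p A) = ρ.p A :=
  (ρ.isStarProjection_p A).isSelfAdjoint.star_eq

theorem p_mul_self (A : G.smallestAcc) : ρ.p A * ρ.p A = ρ.p A :=
  (ρ.isStarProjection_p A).isIdempotentElem.eq

/-- The set `wordRange` as an element of the accommodating collection. -/
def rangeAcc (A : G.smallestAcc) (μ : List 𝒜) : G.smallestAcc :=
  ⟨G.wordRange A μ, wordRange_mem G A.2 μ⟩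

theorem p_mul_word (A : G.smallestAcc) (μ : List 𝒜) :
    ρ.p A * ρ.word μ = ρ.word μ * ρ.p (rangeAcc A μ) := by
  induction μ generalizing A with
  | nil => simp [rangeAcc]
  | cons a μ ih =>
    rw [word_cons, ← mul_assoc, ρ.p_mul_s, mul_assoc, ih, ← mul_assoc]
    rfl

theorem star_word_mul_p (A : G.smallestAcc) (μ : List 𝒜) :
    star (ρ.word μ) * ρ.p A = ρ.p (rangeAcc A μ) * star (ρ.word μ) := by
  simpa using congrArg star (ρ.p_mul_word A μ)

theorem star_s_mul_p_mul_s (A : G.smallestAcc) (a : 𝒜) :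
    star (ρ.s a) * ρ.p A * ρ.s a = ρ.p (rangeAcc A [a]) := by
  rw [mul_assoc, ρ.p_mul_s, ← mul_assoc, ρ.star_s_mul_s, ρ.p_inter]
  congr 1
  refine Subtype.ext (Set.inter_eq_right.2 ?_)
  rintro y ⟨x, -, h⟩
  exact ⟨x, trivial, h⟩

/-- The spanning elements `s_μ p_A s_ν*` of the algebra generated by a representation. -/
noncomputable def mono (μ : List 𝒜) (A : G.smallestAcc) (ν : List 𝒜) : B :=
  ρ.word μ * ρ.p A * star (ρ.word ν)

/-- The linear span of the `s_μ p_A s_ν*` with `μ`, `ν` of equal length: the algebraic part of the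
fixed point algebra of the gauge action. -/
noncomputable def coreSpan : Submodule ℂ B :=
  Submodule.span ℂ {x | ∃ μ A ν, μ.length = ν.length ∧ x = ρ.mono μ A ν}

/-- The linear span of the `s_μ p_A s_ν*` with `μ`, `ν` of different lengths. -/
noncomputable def offSpan : Submodule ℂ B :=
  Submodule.span ℂ {x | ∃ μ A ν, μ.length ≠ ν.length ∧ x = ρ.mono μ A ν}

section Unit

variable {htop : Set.univ ∈ G.smallestAcc} (hone : ρ.p ⟨Set.univ, htop⟩ = 1)
include hone

omit hone in
theorem star_word_mul_p_mul_word (A : G.smallestAcc) (μ : List 𝒜) :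
    star (ρ.word μ) * ρ.p A * ρ.word μ = ρ.p (rangeAcc A μ) := by
  induction μ generalizing A with
  | nil => simp [rangeAcc]
  | cons a μ ih =>
    calc _ = star (ρ.word μ) * (star (ρ.s a) * ρ.p A * ρ.s a) * ρ.word μ := by
          simp [mul_assoc]
      _ = _ := by rw [star_s_mul_p_mul_s, ih]; rfl

theorem star_word_mul_word (μ : List 𝒜) :
    star (ρ.word μ) * ρ.word μ = ρ.p (rangeAcc ⟨Set.univ, htop⟩ μ) := by
  simpa [hone] using ρ.star_word_mul_p_mul_word ⟨Set.univ, htop⟩ μ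

theorem word_mul_p_range (μ : List 𝒜) :
    ρ.word μ * ρ.p (rangeAcc ⟨Set.univ, htop⟩ μ) = ρ.word μ := by
  rw [← p_mul_word, hone, one_mul]

omit hone in
/-- Words that are not comparable for the prefix order have orthogonal ranges. -/
theorem prefix_of_star_word_mul_word_ne_zero {μ ν : List 𝒜}
    (h : star (ρ.word μ) * ρ.word ν ≠ 0) : μ <+: ν ∨ ν <+: μ := by
  induction μ generalizing ν with
  | nil => exact .inl List.nil_prefix
  | cons a μ ih =>
    cases ν with
    | nil => exact .inr List.nil_prefix
    | cons b ν =>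
      have h1 : star (ρ.word (a :: μ)) * ρ.word (b :: ν) =
          star (ρ.word μ) * (star (ρ.s a) * ρ.s b) * ρ.word ν := by
        simp [mul_assoc]
      rw [h1] at h
      by_cases hab : a = b
      · subst hab
        rw [ρ.star_s_mul_s, star_word_mul_p, mul_assoc] at h
        simpa using ih (right_ne_zero_of_mul h)
      · simp [ρ.star_s_mul_s_of_ne a b hab] at h

omit hone in
theorem star_mono (μ : List 𝒜) (A : G.smallestAcc) (ν : List 𝒜) :
    star (ρ.mono μ A ν) = ρ.mono ν A μ := by
  simp [mono, mul_assoc]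

/-- If `κ` is at least as long as `μ`, then `s_κ* s_μ p_A s_ν* s_τ` vanishes unless `κ` extends
`μ`, in which case the same extension of `ν` is compared with `τ`. -/
theorem star_word_mul_mono_mul_word {κ μ ν τ : List 𝒜} {A : G.smallestAcc}
    (hle : μ.length ≤ κ.length) (h : star (ρ.word κ) * ρ.mono μ A ν * ρ.word τ ≠ 0) :
    ∃ κ', κ = μ ++ κ' ∧ star (ρ.word (ν ++ κ')) * ρ.word τ ≠ 0 ∧
      ∃ C C' : G.smallestAcc, star (ρ.word κ) * ρ.mono μ A ν * ρ.word τ =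
        ρ.p C * ρ.p C' * (star (ρ.word (ν ++ κ')) * ρ.word τ) := by
  have h1 : star (ρ.word κ) * ρ.word μ ≠ 0 := by
    intro h0
    apply h
    rw [mono, ← mul_assoc, ← mul_assoc, h0]
    simp
  have h2 : μ <+: κ := by
    rcases ρ.prefix_of_star_word_mul_word_ne_zero h1 with h2 | h2
    · rw [h2.eq_of_length_le hle]
    · exact h2
  obtain ⟨κ', rfl⟩ := h2
  have key : star (ρ.word (μ ++ κ')) * ρ.mono μ A ν * ρ.word τ =
      ρ.p (rangeAcc (rangeAcc ⟨Set.univ, htop⟩ μ) κ') * ρ.p (rangeAcc A κ') *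
        (star (ρ.word (ν ++ κ')) * ρ.word τ) := by
    calc _ = star (ρ.word κ') * (star (ρ.word μ) * ρ.word μ) * ρ.p A * star (ρ.word ν) *
          ρ.word τ := by simp [mono, word_append, mul_assoc]
      _ = ρ.p (rangeAcc (rangeAcc ⟨Set.univ, htop⟩ μ) κ') * (star (ρ.word κ') * ρ.p A) *
          star (ρ.word ν) * ρ.word τ := by
        rw [ρ.star_word_mul_word hone, star_word_mul_p]
        simp only [mul_assoc]
      _ = _ := by
        rw [star_word_mul_p]
        simp [word_append, mul_assoc]
  refine ⟨κ', rfl, fun h0 => h ?_, _, _, key⟩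
  rw [key, h0, mul_zero]

omit hone in
theorem mono_mem (μ : List 𝒜) (A : G.smallestAcc) (ν : List 𝒜) :
    ρ.mono μ A ν ∈ ρ.coreSpan ⊔ ρ.offSpan := by
  by_cases h : μ.length = ν.length
  · exact Submodule.mem_sup_left (Submodule.subset_span ⟨μ, A, ν, h, rfl⟩)
  · exact Submodule.mem_sup_right (Submodule.subset_span ⟨μ, A, ν, h, rfl⟩)

omit hone in
theorem star_mem_coreSpan {x : B} (hx : x ∈ ρ.coreSpan) : star x ∈ ρ.coreSpan := by
  induction hx using Submodule.span_induction with
  | mem x hx =>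
    obtain ⟨μ, A, ν, h, rfl⟩ := hx
    exact Submodule.subset_span ⟨ν, A, μ, h.symm, ρ.star_mono μ A ν⟩
  | zero => simp
  | add x y _ _ hx hy => rw [star_add]; exact add_mem hx hy
  | smul c x _ hx => rw [star_smul]; exact Submodule.smul_mem _ _ hx

omit hone in
theorem star_mem_offSpan {x : B} (hx : x ∈ ρ.offSpan) : star x ∈ ρ.offSpan := by
  induction hx using Submodule.span_induction with
  | mem x hx =>
    obtain ⟨μ, A, ν, h, rfl⟩ := hx
    exact Submodule.subset_span ⟨ν, A, μ, h.symm, ρ.star_mono μ A ν⟩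
  | zero => simp
  | add x y _ _ hx hy => rw [star_add]; exact add_mem hx hy
  | smul c x _ hx => rw [star_smul]; exact Submodule.smul_mem _ _ hx

omit hone in
theorem mul_mem_span {c : B}
    (hc : ∀ μ A ν, c * ρ.mono μ A ν ∈ ρ.coreSpan ⊔ ρ.offSpan) {y : B}
    (hy : y ∈ ρ.coreSpan ⊔ ρ.offSpan) : c * y ∈ ρ.coreSpan ⊔ ρ.offSpan := by
  have hle : ρ.coreSpan ⊔ ρ.offSpan ≤
      (ρ.coreSpan ⊔ ρ.offSpan).comap (LinearMap.mulLeft ℂ c) := by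
    refine sup_le (Submodule.span_le.2 ?_) (Submodule.span_le.2 ?_) <;>
    · rintro _ ⟨μ, A, ν, -, rfl⟩
      exact hc μ A ν
  exact hle hy

/-- The elements `s_μ p_A s_ν*` span the *-algebra generated by the representation. -/
theorem adjoin_le_span {x : B}
    (hx : x ∈ NonUnitalStarAlgebra.adjoin ℂ (Set.range ρ.p ∪ Set.range ρ.s)) :
    x ∈ ρ.coreSpan ⊔ ρ.offSpan := by
  suffices h : ∀ y ∈ ρ.coreSpan ⊔ ρ.offSpan,
      x * y ∈ ρ.coreSpan ⊔ ρ.offSpan ∧ star x * y ∈ ρ.coreSpan ⊔ ρ.offSpan by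
    have h1 : (1 : B) ∈ ρ.coreSpan ⊔ ρ.offSpan := by
      simpa [mono, hone] using ρ.mono_mem [] ⟨Set.univ, htop⟩ []
    simpa using (h 1 h1).1
  have hp : ∀ C, ∀ y ∈ ρ.coreSpan ⊔ ρ.offSpan, ρ.p C * y ∈ ρ.coreSpan ⊔ ρ.offSpan := by
    refine fun C y hy => ρ.mul_mem_span (fun μ A ν => ?_) hy
    have : ρ.p C * ρ.mono μ A ν = ρ.mono μ ⟨_, inter_mem (rangeAcc C μ).2 A.2⟩ ν := by
      rw [mono, mono, ← ρ.p_inter, ← mul_assoc, ← mul_assoc, p_mul_word, ← mul_assoc]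
    rw [this]
    exact ρ.mono_mem _ _ _
  induction hx using NonUnitalStarAlgebra.adjoin_induction with
  | mem x hx =>
    intro y hy
    rcases hx with ⟨C, rfl⟩ | ⟨a, rfl⟩
    · exact ⟨hp C y hy, by rw [star_p]; exact hp C y hy⟩
    · refine ⟨ρ.mul_mem_span (fun μ A ν => ?_) hy, ρ.mul_mem_span (fun μ A ν => ?_) hy⟩
      · have : ρ.s a * ρ.mono μ A ν = ρ.mono (a :: μ) A ν := by simp [mono, mul_assoc]
        rw [this]
        exact ρ.mono_mem _ _ _
      · cases μ with
        | nil =>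
          have : star (ρ.s a) * ρ.mono [] A ν = ρ.mono [] (rangeAcc A [a]) (ν ++ [a]) := by
            have := ρ.star_word_mul_p A [a]
            simp only [word_cons, word_nil, mul_one] at this
            simp only [mono, word_append, word_nil, word_cons, one_mul, mul_one, star_mul,
              ← mul_assoc, this]
          rw [this]
          exact ρ.mono_mem _ _ _
        | cons b μ =>
          have : star (ρ.s a) * ρ.mono (b :: μ) A ν = star (ρ.s a) * ρ.s b * ρ.mono μ A ν := by
            simp [mono, mul_assoc]
          rw [this]
          by_cases hab : a = b
          · subst hab
            rw [ρ.star_s_mul_s]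
            exact hp _ _ (ρ.mono_mem _ _ _)
          · rw [ρ.star_s_mul_s_of_ne a b hab, zero_mul]
            exact zero_mem _
  | add x x' _ _ hx hx' =>
    intro y hy
    rw [star_add, add_mul, add_mul]
    exact ⟨add_mem (hx y hy).1 (hx' y hy).1, add_mem (hx y hy).2 (hx' y hy).2⟩
  | zero => simp
  | mul x x' _ _ hx hx' =>
    intro y hy
    rw [star_mul, mul_assoc, mul_assoc]
    exact ⟨(hx _ (hx' y hy).1).1, (hx' _ (hx y hy).2).2⟩
  | smul c x _ hx =>
    intro y hy
    rw [star_smul, smul_mul_assoc, smul_mul_assoc]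
    exact ⟨Submodule.smul_mem _ _ (hx y hy).1, Submodule.smul_mem _ _ (hx y hy).2⟩
  | star x _ hx =>
    intro y hy
    rw [star_star]
    exact (hx y hy).symm

/-- Compressing an element of the core by long words gives elements of the commutative algebra
spanned by the projections `p_A`. -/
theorem eventually_star_word_mul_mul_word_mem {x : B} (hx : x ∈ ρ.coreSpan) :
    ∀ᶠ k in Filter.atTop, ∀ κ τ : List 𝒜, κ.length = k → τ.length = k →
      star (ρ.word κ) * x * ρ.word τ ∈ Submodule.span ℂ (Set.range ρ.p) := by
  induction hx using Submodule.span_induction with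
  | mem x hx =>
    obtain ⟨μ, A, ν, hl, rfl⟩ := hx
    filter_upwards [Filter.eventually_ge_atTop μ.length] with k hk κ τ hκ hτ
    by_cases h : star (ρ.word κ) * ρ.mono μ A ν * ρ.word τ = 0
    · rw [h]; exact zero_mem _
    obtain ⟨κ', hκ', h1, C, C', h2⟩ :=
      ρ.star_word_mul_mono_mul_word hone (by omega) h
    have hlen : (ν ++ κ').length = τ.length := by
      have := congrArg List.length hκ'
      simp only [List.length_append] at this ⊢
      omega
    have h3 : ν ++ κ' = τ := by
      rcases ρ.prefix_of_star_word_mul_word_ne_zero h1 with h | h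
      · exact h.eq_of_length hlen
      · exact (h.eq_of_length hlen.symm).symm
    rw [h2, h3, ρ.star_word_mul_word hone, ρ.p_inter, ρ.p_inter]
    exact Submodule.subset_span ⟨_, rfl⟩
  | zero => simp
  | add x y _ _ hx hy =>
    filter_upwards [hx, hy] with k hx hy κ τ hκ hτ
    rw [mul_add, add_mul]
    exact add_mem (hx κ τ hκ hτ) (hy κ τ hκ hτ)
  | smul c x _ hx =>
    filter_upwards [hx] with k hx κ τ hκ hτ
    rw [mul_smul_comm, smul_mul_assoc]
    exact Submodule.smul_mem _ _ (hx κ τ hκ hτ)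

/-- The words `κ = σ aᵐ bᵐ` with `a ≠ b` are aperiodic: compression by `κ` kills every given
off-diagonal element once `m` is large. -/
theorem eventually_star_word_mul_mul_word_eq_zero {a b : 𝒜} (hab : a ≠ b) {x : B}
    (hx : x ∈ ρ.offSpan) :
    ∀ᶠ m in Filter.atTop, ∀ κ τ σ : List 𝒜, κ.length = τ.length →
      star (ρ.word (κ ++ (σ ++ (List.replicate m a ++ List.replicate m b)))) * x *
        ρ.word (τ ++ (σ ++ (List.replicate m a ++ List.replicate m b))) = 0 := by
  induction hx using Submodule.span_induction with
  | mem x hx =>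
    obtain ⟨μ, A, ν, hl, rfl⟩ := hx
    filter_upwards [Filter.eventually_gt_atTop (μ.length + ν.length)] with m hm κ τ σ hκτ
    by_contra h
    obtain ⟨κ', hκ', h1, -⟩ := ρ.star_word_mul_mono_mul_word hone (by simp; omega) h
    -- Comparing letters, position `i + |μ|` of the left word and position `i + |ν|` of the right
    -- word agree.
    have h2 : ∀ i, ∀ c d : 𝒜,
        (κ ++ (σ ++ (List.replicate m a ++ List.replicate m b)))[i + μ.length]? = some c →
        (τ ++ (σ ++ (List.replicate m a ++ List.replicate m b)))[i + ν.length]? = some d →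
        c = d := by
      intro i c d hc hd
      rw [hκ', List.getElem?_append_right (by omega), Nat.add_sub_cancel] at hc
      have hc' : (ν ++ κ')[i + ν.length]? = some c := by
        rw [List.getElem?_append_right (by omega), Nat.add_sub_cancel, hc]
      rcases ρ.prefix_of_star_word_mul_word_ne_zero h1 with h | h
      · exact Option.some.inj ((List.IsPrefix.getElem?_eq_some h hc').symm.trans hd)
      · exact Option.some.inj (hc'.symm.trans (List.IsPrefix.getElem?_eq_some h hd))
    -- The letters of both words at the position of the last `a` and shortly after it.
    have ha : ∀ η : List 𝒜, η.length = τ.length →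
        (η ++ (σ ++ (List.replicate m a ++ List.replicate m b)))[
          τ.length + σ.length + (m - 1)]? = some a := by
      intro η hη
      rw [List.getElem?_append_right (by omega), List.getElem?_append_right (by omega),
        List.getElem?_append_left (by simp; omega), List.getElem?_replicate]
      rw [if_pos (by omega)]
    have hb : ∀ η : List 𝒜, η.length = τ.length → ∀ j, m ≤ j → j < 2 * m →
        (η ++ (σ ++ (List.replicate m a ++ List.replicate m b)))[
          τ.length + σ.length + j]? = some b := by
      intro η hη j hj hj'
      rw [List.getElem?_append_right (by omega), List.getElem?_append_right (by omega),
        List.getElem?_append_right (by simp; omega), List.getElem?_replicate]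
      rw [if_pos (by simp; omega)]
    rcases Nat.lt_or_gt_of_ne hl with hl | hl
    · refine hab (h2 (τ.length + σ.length + (m - 1) - μ.length) a b ?_ ?_)
      · rw [Nat.sub_add_cancel (by omega)]
        exact ha κ hκτ
      · have := hb τ rfl (m - 1 + (ν.length - μ.length)) (by omega) (by omega)
        rwa [show τ.length + σ.length + (m - 1) - μ.length + ν.length =
          τ.length + σ.length + (m - 1 + (ν.length - μ.length)) by omega]
    · refine hab (h2 (τ.length + σ.length + (m - 1) - ν.length) b a ?_ ?_).symm
      · have := hb κ hκτ (m - 1 + (μ.length - ν.length)) (by omega) (by omega)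
        rwa [show τ.length + σ.length + (m - 1) - ν.length + μ.length =
          τ.length + σ.length + (m - 1 + (μ.length - ν.length)) by omega]
      · rw [Nat.sub_add_cancel (by omega)]
        exact ha τ rfl
  | zero => simp
  | add x y _ _ hx hy =>
    filter_upwards [hx, hy] with m hx hy κ τ σ h
    rw [mul_add, add_mul, hx κ τ σ h, hy κ τ σ h, add_zero]
  | smul c x _ hx =>
    filter_upwards [hx] with m hx κ τ σ h
    rw [mul_smul_comm, smul_mul_assoc, hx κ τ σ h, smul_zero]

end Unit

/-- The projection of a set that is a finite disjoint union. -/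
theorem p_eq_sum_of_iUnion {ι : Type*} [Fintype ι] (C : ι → G.smallestAcc)
    (hC : ∀ i j, i ≠ j → (C i : Set V) ∩ C j = ∅) (A : G.smallestAcc)
    (hA : ⋃ i, (C i : Set V) = A) : ρ.p A = ∑ i, ρ.p (C i) := by
  classical
  have key : ∀ s : Finset ι, ∃ h : (⋃ i ∈ s, (C i : Set V)) ∈ G.smallestAcc,
      ρ.p ⟨_, h⟩ = ∑ i ∈ s, ρ.p (C i) := by
    intro s
    induction s using Finset.induction_on with
    | empty => exact ⟨by simpa using empty_mem, by simpa using ρ.p_empty⟩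
    | insert i s hi ih =>
      obtain ⟨h, ih⟩ := ih
      have h1 : (⋃ j ∈ insert i s, (C j : Set V)) = (C i : Set V) ∪ ⋃ j ∈ s, (C j : Set V) := by
        simp
      have h2 : (C i : Set V) ∩ ⋃ j ∈ s, (C j : Set V) = ∅ := by
        rw [Set.inter_iUnion₂]
        simp only [Set.iUnion_eq_empty]
        exact fun j hj => hC i j fun hij => hi (hij ▸ hj)
      refine ⟨h1 ▸ union_mem (C i).2 h, ?_⟩
      rw [Finset.sum_insert hi, ← ih]
      simp only [h1]
      have := ρ.p_union (C i) ⟨_, h⟩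
      simp only [h2, ρ.p_empty, sub_zero] at this
      exact this
  obtain ⟨h, h1⟩ := key Finset.univ
  rw [← h1]
  congr 1
  exact Subtype.ext (by simp [hA])

section Fintype

variable [Fintype 𝒜]

theorem p_eq_sum_univ (A : G.smallestAcc) :
    ρ.p A = ∑ a, ρ.s a * ρ.p (rangeAcc A [a]) * star (ρ.s a) := by
  classical
  rw [ρ.p_eq_sum A (Set.toFinite _)]
  refine Finset.sum_subset (Finset.subset_univ _) fun a _ ha => ?_
  have : ρ.p (rangeAcc A [a]) = 0 := by
    rw [← ρ.p_empty]
    congr 1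
    exact Subtype.ext (relRange_eq_empty_of_notMem_emitted G (by simpa using ha))
  change ρ.s a * ρ.p (rangeAcc A [a]) * star (ρ.s a) = 0
  simp [this]

theorem sum_word_mul_p_mul_star_word (k : ℕ) (A : G.smallestAcc) :
    ∑ f : Fin k → 𝒜, ρ.word (List.ofFn f) * ρ.p (rangeAcc A (List.ofFn f)) *
      star (ρ.word (List.ofFn f)) = ρ.p A := by
  induction k generalizing A with
  | zero => simp [rangeAcc]
  | succ k ih =>
    rw [← (Fin.consEquiv fun _ => 𝒜).sum_comp, Fintype.sum_prod_type, ρ.p_eq_sum_univ A]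
    refine Finset.sum_congr rfl fun a _ => ?_
    rw [← ih (rangeAcc A [a]), Finset.mul_sum, Finset.sum_mul]
    refine Finset.sum_congr rfl fun f _ => ?_
    simp [Fin.consEquiv, List.ofFn_succ, rangeAcc, mul_assoc]

theorem sum_word_mul_star_word {htop : Set.univ ∈ G.smallestAcc}
    (hone : ρ.p ⟨Set.univ, htop⟩ = 1) (k : ℕ) :
    ∑ f : Fin k → 𝒜, ρ.word (List.ofFn f) * star (ρ.word (List.ofFn f)) = 1 := by
  have := ρ.sum_word_mul_p_mul_star_word k ⟨Set.univ, htop⟩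
  simpa only [ρ.word_mul_p_range hone, hone] using this

end Fintype

end LabelledGraph.Representation

/-! ### Compression to an eigenvector of a matrix over a system of matrix units -/

section MatrixUnits

variable {A : Type*} [CStarAlgebra A]

theorem star_sum_smul_mul_mul_sum_smul {ι : Type*} [Fintype ι] (e : ι → A) (c : A) (ξ η : ι → ℂ) :
    star (∑ i, ξ i • e i) * c * ∑ j, η j • e j =
      ∑ i, ∑ j, (star (ξ i) * η j) • (star (e i) * c * e j) := by
  simp only [star_sum, star_smul, Finset.sum_mul, Finset.mul_sum, smul_mul_assoc, mul_smul_comm,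
    Finset.smul_sum]
  rw [Finset.sum_comm]
  refine Finset.sum_congr rfl fun i _ => Finset.sum_congr rfl fun j _ => ?_
  rw [smul_smul, mul_comm]

/-- The rank one elements given by the columns of `U` sum up to the element given by the matrix
`U D U*`. -/
theorem sum_smul_mul_star_eq {ι : Type*} [Fintype ι] [DecidableEq ι] (e : ι → A)
    (U : Matrix ι ι ℂ) (θ : ι → ℂ) :
    ∑ t, θ t • ((∑ i, U i t • e i) * star (∑ i, U i t • e i)) =
      ∑ i, ∑ j, (U * Matrix.diagonal θ * star U) i j • (e i * star (e j)) := by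
  simp only [Matrix.mul_apply (M := U * Matrix.diagonal θ), Matrix.mul_diagonal, star_sum, star_smul,
    Finset.sum_mul, Finset.mul_sum, smul_mul_assoc, mul_smul_comm, smul_smul, Finset.smul_sum,
    Finset.sum_smul, Matrix.star_apply]
  rw [Finset.sum_comm]
  conv_rhs => rw [Finset.sum_comm]
  refine Finset.sum_congr rfl fun j _ => ?_
  rw [Finset.sum_comm]
  refine Finset.sum_congr rfl fun i _ => Finset.sum_congr rfl fun t _ => ?_
  congr 1
  ring

variable [PartialOrder A] [StarOrderedRing A] [Nontrivial A]

/-- Let `c` be a self-adjoint element that is block diagonal with respect to partial isometries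
`e w i` with pairwise orthogonal ranges that sum up to `1`, each block being a scalar matrix over
the common source projection `p w`. An eigenvector of one of the blocks compresses `c` to a scalar
multiple of `p w`, and the eigenvalue can be chosen at least as large as the norm of `c`. -/
theorem exists_eigenvector_compression {W : Type*} [Fintype W] {ι : W → Type*}
    [∀ w, Fintype (ι w)] [∀ w, DecidableEq (ι w)] {p : W → A} (hp : ∀ w, p w ≠ 0)
    (e : ∀ w, ι w → A)
    (he : ∀ w i j, star (e w i) * e w j = if i = j then p w else 0)
    (hep : ∀ w i, e w i * p w = e w i)
    (hsum : ∑ w, ∑ i, e w i * star (e w i) = 1)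
    {c : A} (hc : IsSelfAdjoint c) (Λ : ∀ w, Matrix (ι w) (ι w) ℂ)
    (hΛ : ∀ w i j, star (e w i) * c * e w j = Λ w i j • p w)
    (hcross : ∀ w w' i j, w ≠ w' → star (e w i) * c * e w' j = 0) :
    ∃ w, ∃ ξ : ι w → ℂ, ∃ θ : ℝ, ‖c‖ ≤ |θ| ∧
      star (∑ i, ξ i • e w i) * ∑ i, ξ i • e w i = p w ∧
      star (∑ i, ξ i • e w i) * c * ∑ i, ξ i • e w i = (θ : ℂ) • p w := by
  classical
  have hps : ∀ w (i : ι w), star (p w) = p w := by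
    intro w i
    have := he w i i
    rw [if_pos rfl] at this
    rw [← this, star_mul, star_star]
  have hherm : ∀ w, (Λ w).IsHermitian := by
    intro w
    ext i j
    have h1 := congrArg star (hΛ w j i)
    simp only [star_mul, star_star, star_smul, hc.star_eq, hps w i] at h1
    rw [← mul_assoc, hΛ] at h1
    exact (smul_left_injective ℂ (hp w) h1).symm
  set U : ∀ w, Matrix (ι w) (ι w) ℂ := fun w => (hherm w).eigenvectorUnitary with hU
  set θ : ∀ w, ι w → ℝ := fun w => (hherm w).eigenvalues with hθ
  have hUU : ∀ w, star (U w) * U w = 1 := fun w => Unitary.coe_star_mul_self _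
  have hUU' : ∀ w, U w * star (U w) = 1 := fun w => Unitary.coe_mul_star_self _
  have hspec : ∀ w, U w * Matrix.diagonal (fun t => (θ w t : ℂ)) * star (U w) = Λ w := by
    intro w
    exact ((hherm w).spectral_theorem).symm
  have hspec' : ∀ w, star (U w) * Λ w * U w = Matrix.diagonal (fun t => (θ w t : ℂ)) := by
    intro w
    rw [← hspec, mul_assoc, mul_assoc, hUU, mul_one, ← mul_assoc, hUU, one_mul]
  set v : ∀ w, ι w → A := fun w t => ∑ i, U w i t • e w i with hv
  have hvv : ∀ w t, star (v w t) * v w t = p w := by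
    intro w t
    have h1 := star_sum_smul_mul_mul_sum_smul (e w) 1 (fun i => U w i t) (fun i => U w i t)
    simp only [mul_one, he, smul_ite, smul_zero, Finset.sum_ite_eq, Finset.mem_univ,
      if_true] at h1
    rw [hv]
    refine h1.trans ?_
    rw [← Finset.sum_smul]
    have := congrFun (congrFun (hUU w) t) t
    simp only [Matrix.mul_apply, Matrix.star_apply, Matrix.one_apply_eq] at this
    rw [this, one_smul]
  have hvc : ∀ w t, star (v w t) * c * v w t = (θ w t : ℂ) • p w := by
    intro w t
    have h1 := star_sum_smul_mul_mul_sum_smul (e w) c (fun i => U w i t) (fun i => U w i t)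
    simp only [hΛ, smul_smul, ← Finset.sum_smul] at h1
    rw [hv]
    refine h1.trans ?_
    congr 1
    have := congrFun (congrFun (hspec' w) t) t
    simp only [Matrix.mul_apply, Matrix.star_apply, Matrix.diagonal_apply_eq, Finset.sum_mul] at this
    rw [← this, Finset.sum_comm]
    refine Finset.sum_congr rfl fun i _ => Finset.sum_congr rfl fun j _ => ?_
    ring
  have hone : ∑ w, ∑ t, v w t * star (v w t) = 1 := by
    rw [← hsum]
    refine Finset.sum_congr rfl fun w _ => ?_
    have := sum_smul_mul_star_eq (e w) (U w) (fun _ => 1)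
    rw [Matrix.diagonal_one, mul_one, hUU'] at this
    simpa only [Matrix.one_apply, ite_smul, one_smul, zero_smul, Finset.sum_ite_eq,
      Finset.mem_univ, if_true] using this
  have hcsum : c = ∑ w, ∑ t, (θ w t : ℂ) • (v w t * star (v w t)) := by
    have h1 : ∀ w, ∑ t, (θ w t : ℂ) • (v w t * star (v w t)) =
        ∑ i, ∑ j, e w i * star (e w i) * c * (e w j * star (e w j)) := by
      intro w
      rw [sum_smul_mul_star_eq, hspec]
      refine Finset.sum_congr rfl fun i _ => Finset.sum_congr rfl fun j _ => ?_
      calc Λ w i j • (e w i * star (e w j)) = e w i * (Λ w i j • p w) * star (e w j) := by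
            rw [mul_smul_comm, hep, smul_mul_assoc]
        _ = _ := by rw [← hΛ]; simp only [mul_assoc]
    calc c = 1 * c * 1 := by simp
      _ = ∑ w, ∑ w', ∑ i, ∑ j, e w i * star (e w i) * c * (e w' j * star (e w' j)) := by
        rw [← hsum]
        simp only [Finset.sum_mul, Finset.mul_sum]
        conv_rhs => rw [Finset.sum_comm]
        refine Finset.sum_congr rfl fun w' _ => ?_
        rw [Finset.sum_comm]
        exact Finset.sum_congr rfl fun w _ => Finset.sum_comm
      _ = _ := by
        refine Finset.sum_congr rfl fun w _ => ?_
        rw [h1, Finset.sum_eq_single w]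
        · intro w' _ hw
          refine Finset.sum_eq_zero fun i _ => Finset.sum_eq_zero fun j _ => ?_
          have := hcross w w' i j hw.symm
          rw [show e w i * star (e w i) * c * (e w' j * star (e w' j)) =
            e w i * (star (e w i) * c * e w' j) * star (e w' j) by simp only [mul_assoc], this]
          simp
        · simp
  have hnonempty : Nonempty (Σ w, ι w) := by
    by_contra hempty
    rw [not_nonempty_iff, isEmpty_sigma] at hempty
    have : ∑ w, ∑ i, e w i * star (e w i) = 0 :=
      Finset.sum_eq_zero fun w _ => by
        have := hempty w
        simp
    exact one_ne_zero (hsum.symm.trans this)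
  obtain ⟨⟨w, t⟩, hmax⟩ := Finite.exists_max fun x : Σ w, ι w => |θ x.1 x.2|
  refine ⟨w, fun i => U w i t, θ w t, ?_, hvv w t, hvc w t⟩
  set M := |θ w t|
  have hpos : ∀ r : ∀ w, ι w → ℝ, (∀ w t, 0 ≤ r w t) →
      0 ≤ ∑ w, ∑ t, (r w t : ℂ) • (v w t * star (v w t)) := fun r hr =>
    Finset.sum_nonneg fun w _ => Finset.sum_nonneg fun t _ =>
      by rw [Complex.coe_smul]; exact smul_nonneg (hr w t) (mul_star_self_nonneg _)
  have hM : algebraMap ℝ A M = ∑ w, ∑ t, (M : ℂ) • (v w t * star (v w t)) := by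
    simp_rw [← Finset.smul_sum]
    rw [hone, Algebra.algebraMap_eq_smul_one]
    simp
  have h1 : c ≤ algebraMap ℝ A M := by
    rw [← sub_nonneg, hM, hcsum]
    simp_rw [← Finset.sum_sub_distrib, ← sub_smul]
    have := hpos (fun w t => M - θ w t) fun w t =>
      sub_nonneg.2 ((le_abs_self _).trans (hmax ⟨w, t⟩))
    simpa using this
  have h2 : -algebraMap ℝ A M ≤ c := by
    rw [← sub_nonneg, sub_neg_eq_add, hM, hcsum]
    simp_rw [← Finset.sum_add_distrib, ← add_smul]
    have := hpos (fun w t => θ w t + M) fun w t => by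
      have := (neg_le_abs (θ w t)).trans (hmax ⟨w, t⟩)
      change -θ w t ≤ M at this
      linarith
    simpa using this
  rcases CStarAlgebra.norm_or_neg_norm_mem_spectrum hc with h | h
  · exact (le_algebraMap_iff_spectrum_le hc).1 h1 _ h
  · rw [← map_neg] at h2
    exact neg_le_neg_iff.1 ((algebraMap_le_iff_le_spectrum hc).1 h2 _ h)

end MatrixUnits

/-! ### Compression by isometries in a representation of the Dyck graph -/

section Dyck

open LabelledGraph LabelledGraph.Representation

noncomputable instance (N : ℕ) : Fintype (DyckLetter N) := by
  classical
  exact Fintype.ofSurjective (Sum.elim DyckLetter.opening DyckLetter.closing) fun a => by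
    cases a with
    | opening i => exact ⟨.inl i, rfl⟩
    | closing i => exact ⟨.inr i, rfl⟩

variable {N : ℕ} {V : Type u} {T : NaryTree N V} {A : Type*} [CStarAlgebra A]
  (ρ : T.dyckGraph.Representation A)

namespace NaryTree

/-- A cylinder set as an element of the accommodating collection. -/
def cylinderAcc (T : NaryTree N V) (hN : 1 ≤ N) {L : ℕ} (w : Fin L → Fin N) :
    T.dyckGraph.smallestAcc := ⟨T.cylinder w, T.cylinder_mem hN w⟩

variable (hN : 1 ≤ N) (hone : ρ.p ⟨Set.univ, T.univ_mem hN⟩ = 1)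

theorem p_cylinder_mul {L : ℕ} {w w' : Fin L → Fin N} (h : w ≠ w') :
    ρ.p (T.cylinderAcc hN w) * ρ.p (T.cylinderAcc hN w') = 0 := by
  rw [ρ.p_inter, ← ρ.p_empty]
  congr 1
  exact Subtype.ext (T.cylinder_disjoint h)

/-- Long cylinder projections are minimal with respect to each given projection `p_C`. -/
theorem eventually_p_cylinder_mul (C : T.dyckGraph.smallestAcc) :
    ∀ᶠ L in Filter.atTop, ∀ w : Fin L → Fin N,
      ρ.p (T.cylinderAcc hN w) * ρ.p C = ρ.p (T.cylinderAcc hN w) ∨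
      ρ.p (T.cylinderAcc hN w) * ρ.p C = 0 := by
  filter_upwards [T.eventually_cylinder_inter C.2] with L hL w
  rw [ρ.p_inter]
  refine (hL w).imp (fun h => ?_) (fun h => ?_)
  · congr 1
    exact Subtype.ext h
  · rw [← ρ.p_empty]
    congr 1
    exact Subtype.ext h

theorem eventually_p_cylinder_mul_mul {y : A} (hy : y ∈ Submodule.span ℂ (Set.range ρ.p)) :
    ∀ᶠ L in Filter.atTop, ∀ w : Fin L → Fin N, ∃ c : ℂ,
      ρ.p (T.cylinderAcc hN w) * y = c • ρ.p (T.cylinderAcc hN w) := by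
  induction hy using Submodule.span_induction with
  | mem x hx =>
    obtain ⟨C, rfl⟩ := hx
    filter_upwards [eventually_p_cylinder_mul ρ hN C] with L hL w
    rcases hL w with h | h
    · exact ⟨1, by rw [h, one_smul]⟩
    · exact ⟨0, by rw [h, zero_smul]⟩
  | zero => exact .of_forall fun L w => ⟨0, by simp⟩
  | add x y _ _ hx hy =>
    filter_upwards [hx, hy] with L hx hy w
    obtain ⟨c, hc⟩ := hx w
    obtain ⟨d, hd⟩ := hy w
    exact ⟨c + d, by rw [mul_add, hc, hd, add_smul]⟩
  | smul r x _ hx =>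
    filter_upwards [hx] with L hx w
    obtain ⟨c, hc⟩ := hx w
    exact ⟨r * c, by rw [mul_smul_comm, hc, smul_smul]⟩

include hone

/-- The word closing the brackets of a cylinder set, followed by any balanced word `αᵐ βᵐ`,
compresses the cylinder projection to the unit. -/
theorem star_word_mul_p_cylinder_mul_word {L : ℕ} (w : Fin L → Fin N) (i : Fin N) (m : ℕ) :
    star (ρ.word (List.ofFn (fun j => DyckLetter.closing (w j)) ++
      (List.replicate m (.opening i) ++ List.replicate m (.closing i)))) *
      ρ.p (T.cylinderAcc hN w) *
      ρ.word (List.ofFn (fun j => DyckLetter.closing (w j)) ++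
        (List.replicate m (.opening i) ++ List.replicate m (.closing i))) = 1 := by
  rw [star_word_mul_p_mul_word, ← hone]
  congr 1
  refine Subtype.ext ?_
  change T.dyckGraph.wordRange (T.cylinder w) _ = _
  rw [wordRange_append, wordRange_cylinder, wordRange_opening_closing]

theorem p_cylinder_ne_zero [Nontrivial A] {L : ℕ} (w : Fin L → Fin N) :
    ρ.p (T.cylinderAcc hN w) ≠ 0 := by
  intro h
  have := star_word_mul_p_cylinder_mul_word ρ hN hone w ⟨0, hN⟩ 0
  rw [h] at this
  simp at this

theorem sum_p_cylinder (L : ℕ) : ∑ w : Fin L → Fin N, ρ.p (T.cylinderAcc hN w) = 1 := by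
  rw [← hone]
  refine (ρ.p_eq_sum_of_iUnion (T.cylinderAcc hN) ?_ _ (T.iUnion_cylinder L)).symm
  exact fun w w' h => T.cylinder_disjoint h

/-- A self-adjoint element of the algebraic core, perturbed by an off-diagonal element, is
compressed by an isometry to a scalar that is at least as large as the norm of its core part. -/
theorem exists_isometry_compression [Nontrivial A] {b x : A} (hb : b ∈ ρ.coreSpan)
    (hbs : IsSelfAdjoint b) (hx : x ∈ ρ.offSpan) :
    ∃ (y : A) (θ : ℝ), star y * y = 1 ∧ ‖b‖ ≤ |θ| ∧ star y * (b + x) * y = (θ : ℂ) • 1 := by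
  classical
  let _ := CStarAlgebra.spectralOrder A
  have _ := CStarAlgebra.spectralOrderedRing A
  -- The length `k` is so large that the compressions `s_f* b s_g` lie in the span of the `p_A`, and
  -- the length `L` so large that each `p_w` is minimal for these finitely many elements.
  obtain ⟨k, hk⟩ := (ρ.eventually_star_word_mul_mul_word_mem hone hb).exists
  obtain ⟨L, hL1, hL2⟩ := ((Filter.eventually_all.2 fun f : Fin k → DyckLetter N =>
    Filter.eventually_all.2 fun g : Fin k → DyckLetter N =>
      eventually_p_cylinder_mul_mul ρ hN
        (hk (List.ofFn f) (List.ofFn g) List.length_ofFn List.length_ofFn)).and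
    (Filter.eventually_all.2 fun f : Fin k → DyckLetter N => eventually_p_cylinder_mul ρ hN
      (rangeAcc ⟨Set.univ, T.univ_mem hN⟩ (List.ofFn f)))).exists
  choose Λ hΛ using hL1
  set p : (Fin L → Fin N) → A := fun w => ρ.p (T.cylinderAcc hN w) with hp
  have hpp : ∀ w, p w * p w = p w := fun w => ρ.p_mul_self _
  have hps : ∀ w, star (p w) = p w := fun w => ρ.star_p _
  set S : (Fin k → DyckLetter N) → A := fun f => ρ.word (List.ofFn f) with hS
  have hSS : ∀ f g, f ≠ g → star (S f) * S g = 0 := by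
    intro f g hfg
    by_contra h
    have hlen : (List.ofFn f).length = (List.ofFn g).length := by simp
    refine hfg (List.ofFn_injective ?_)
    rcases ρ.prefix_of_star_word_mul_word_ne_zero h with h | h
    · exact h.eq_of_length hlen
    · exact (h.eq_of_length hlen.symm).symm
  have he : ∀ w f, star (S f * p w) * (S f * p w) = p w ∨ S f * p w = 0 := by
    intro w f
    have h1 : star (S f * p w) * (S f * p w) =
        p w * ρ.p (rangeAcc ⟨Set.univ, T.univ_mem hN⟩ (List.ofFn f)) * p w := by
      rw [← ρ.star_word_mul_word hone, star_mul, hps]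
      simp only [mul_assoc, hS]
    rcases hL2 f w with h | h
    · left
      rw [h1, h, hpp]
    · right
      rw [h, zero_mul] at h1
      exact (CStarRing.star_mul_self_eq_zero_iff _).1 h1
  have hcomp : ∀ w w' f g, star (S f * p w) * b * (S g * p w') =
      p w * (star (S f) * b * S g) * p w' := by
    intro w w' f g
    rw [star_mul, hps]
    simp only [mul_assoc]
  have hsum : ∑ w, ∑ f : {f // S f * p w ≠ 0}, S f * p w * star (S f * p w) = 1 := by
    have h1 : ∀ w, ∑ f : {f // S f * p w ≠ 0}, S f * p w * star (S f * p w) =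
        ∑ f, S f * p w * star (S f) := by
      intro w
      rw [← Finset.sum_subtype (Finset.univ.filter fun f => S f * p w ≠ 0) (by simp)
        (fun f => S f * p w * star (S f * p w)), Finset.sum_filter_of_ne]
      · refine Finset.sum_congr rfl fun f _ => ?_
        rw [star_mul, hps, ← mul_assoc, mul_assoc (S f), hpp]
      · intro f _ h h0
        rw [h0] at h
        simp at h
    simp_rw [h1]
    rw [Finset.sum_comm]
    simp_rw [← Finset.sum_mul, ← Finset.mul_sum]
    rw [hp, sum_p_cylinder ρ hN hone]
    simpa only [mul_one] using ρ.sum_word_mul_star_word hone k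
  -- For fixed `w`, the nonzero elements `s_f p_w` give a system of matrix units.
  obtain ⟨w, ξ, θ, hθ, hv1, hv2⟩ := exists_eigenvector_compression
    (ι := fun w => {f // S f * p w ≠ 0}) (p := p) (p_cylinder_ne_zero ρ hN hone)
    (fun w f => S f * p w) (fun w f g => by
      by_cases hfg : f = g
      · subst hfg
        rw [if_pos rfl]
        exact (he w f).resolve_right f.2
      · rw [if_neg hfg, star_mul, mul_assoc, ← mul_assoc (star (S f)),
          hSS f g fun h => hfg (Subtype.ext h)]
        simp)
    (fun w f => by rw [mul_assoc, hpp]) hsum hbs (fun w f g => Λ f g w)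
    (fun w f g => by rw [hcomp, hΛ, smul_mul_assoc, hpp])
    (fun w w' f g hw => by
      rw [hcomp, hΛ, smul_mul_assoc, p_cylinder_mul ρ hN hw, smul_zero])
  -- The word `κ` returns from `V_w` to the full vertex set and is aperiodic.
  have hab : DyckLetter.opening (⟨0, hN⟩ : Fin N) ≠ .closing ⟨0, hN⟩ := by simp
  obtain ⟨m, hm⟩ := (ρ.eventually_star_word_mul_mul_word_eq_zero hone hab hx).exists
  set κ : List (DyckLetter N) := List.ofFn (fun j => DyckLetter.closing (w j)) ++
      (List.replicate m (.opening ⟨0, hN⟩) ++ List.replicate m (.closing ⟨0, hN⟩)) with hκ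
  have hκp : star (ρ.word κ) * p w * ρ.word κ = 1 :=
    star_word_mul_p_cylinder_mul_word ρ hN hone w ⟨0, hN⟩ m
  have hpκ : p w * ρ.word κ = ρ.word κ := by
    rw [hp, p_mul_word]
    have : rangeAcc (T.cylinderAcc hN w) κ = ⟨Set.univ, T.univ_mem hN⟩ := by
      refine Subtype.ext ?_
      change T.dyckGraph.wordRange (T.cylinder w) _ = _
      rw [hκ, wordRange_append, wordRange_cylinder, wordRange_opening_closing]
    rw [this, hone, mul_one]
  set v := ∑ f : {f // S f * p w ≠ 0}, ξ f • (S f * p w) with hv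
  refine ⟨v * ρ.word κ, θ, ?_, hθ, ?_⟩
  · calc _ = star (ρ.word κ) * (star v * v) * ρ.word κ := by simp [mul_assoc]
      _ = 1 := by rw [hv1, hκp]
  · have h1 : star (v * ρ.word κ) * b * (v * ρ.word κ) = (θ : ℂ) • 1 := by
      calc _ = star (ρ.word κ) * (star v * b * v) * ρ.word κ := by simp [mul_assoc]
        _ = _ := by rw [hv2, mul_smul_comm, smul_mul_assoc, hκp]
    have h2 : v * ρ.word κ = ∑ f : {f // S f * p w ≠ 0},
        ξ f • ρ.word (List.ofFn (f : Fin k → DyckLetter N) ++ κ) := by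
      rw [hv, Finset.sum_mul]
      refine Finset.sum_congr rfl fun f _ => ?_
      rw [smul_mul_assoc, mul_assoc, hpκ, ρ.word_append _ κ]
    have h3 : star (v * ρ.word κ) * x * (v * ρ.word κ) = 0 := by
      rw [h2, star_sum_smul_mul_mul_sum_smul]
      refine Finset.sum_eq_zero fun f _ => Finset.sum_eq_zero fun g _ => ?_
      rw [hm _ _ _ (by simp), smul_zero]
    rw [mul_add, add_mul, h1, h3, add_zero]

end NaryTree

end Dyck

/-! ### Averages over the gauge action -/

section Gauge

variable {B : Type*} [CStarAlgebra B]

/-- The average of a circle action over the `n`-th roots of unity (zero for `n = 0`). -/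
noncomputable def gaugeAverage (γ : Circle → B →⋆ₙₐ[ℂ] B) (n : ℕ) : B →ₗ[ℂ] B :=
  (n : ℂ)⁻¹ • ∑ j ∈ Finset.range n,
    ({ toFun := γ (Circle.exp (2 * Real.pi / n) ^ j)
       map_add' := map_add _
       map_smul' := map_smul _ } : B →ₗ[ℂ] B)

theorem gaugeAverage_apply (γ : Circle → B →⋆ₙₐ[ℂ] B) (n : ℕ) (a : B) :
    gaugeAverage γ n a =
      (n : ℂ)⁻¹ • ∑ j ∈ Finset.range n, γ (Circle.exp (2 * Real.pi / n) ^ j) a := by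
  simp [gaugeAverage, LinearMap.sum_apply]

theorem norm_gaugeAverage_le (γ : Circle → B →⋆ₙₐ[ℂ] B) (n : ℕ) (a : B) :
    ‖gaugeAverage γ n a‖ ≤ ‖a‖ := by
  rw [gaugeAverage_apply, norm_smul, norm_inv, Complex.norm_natCast]
  have h1 : ‖∑ j ∈ Finset.range n, γ (Circle.exp (2 * Real.pi / n) ^ j) a‖ ≤ n * ‖a‖ := by
    refine (norm_sum_le _ _).trans ?_
    refine (Finset.sum_le_sum fun j _ => NonUnitalStarAlgHom.norm_apply_le _ a).trans ?_
    simp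
  rcases Nat.eq_zero_or_pos n with rfl | hn
  · simp
  · rw [inv_mul_le_iff₀ (by exact_mod_cast hn)]
    exact h1

/-- Averages over finer and finer roots of unity do not make a positive element small: a fixed
proportion of the roots of unity moves the element only a little. -/
theorem exists_le_norm_gaugeAverage (γ : Circle → B →⋆ₙₐ[ℂ] B) {h : B} (hh : h ≠ 0)
    (hcont : Filter.Tendsto (fun z => γ z (star h * h)) (nhds 1) (nhds (star h * h))) :
    ∃ c > 0, ∃ m > 0, ∀ K > 0, c ≤ ‖gaugeAverage γ (m * K) (star h * h)‖ := by
  let _ := CStarAlgebra.spectralOrder B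
  have _ := CStarAlgebra.spectralOrderedRing B
  set a := star h * h with ha
  have ha0 : 0 < ‖a‖ := norm_pos_iff.2 fun h0 => hh ((CStarRing.star_mul_self_eq_zero_iff h).1 h0)
  have hpos : ∀ z, 0 ≤ γ z a := fun z => by
    rw [ha, map_mul, map_star]
    exact star_mul_self_nonneg _
  have hexp : Filter.Tendsto (fun t : ℝ => γ (Circle.exp t) a) (nhds 0) (nhds a) := by
    refine hcont.comp ?_
    have := Circle.exp.continuous.tendsto 0
    rwa [Circle.exp_zero] at this
  obtain ⟨δ, hδ, hδa⟩ := Metric.tendsto_nhds_nhds.1 hexp (‖a‖ / 2) (by positivity)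
  -- Among the `m K`-th roots of unity the first `K` lie in an arc of length `2π/m < δ`.
  obtain ⟨m, hm⟩ := exists_nat_gt (2 * Real.pi / δ)
  have hm0 : 0 < (m : ℝ) := lt_of_le_of_lt (by positivity) hm
  have hmδ : 2 * Real.pi / m < δ := by
    rw [div_lt_iff₀ hδ] at hm
    rw [div_lt_iff₀ hm0]
    linarith
  refine ⟨‖a‖ / (2 * m), by positivity, m, by exact_mod_cast hm0, fun K hK => ?_⟩
  have hK0 : 0 < (K : ℝ) := by exact_mod_cast hK
  set g : ℕ → B := fun j => γ (Circle.exp (2 * Real.pi / (m * K : ℕ)) ^ j) a with hg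
  have hclose : ∀ j ∈ Finset.range K, ‖g j - a‖ ≤ ‖a‖ / 2 := by
    intro j hj
    have hj' : (j : ℝ) < K := by exact_mod_cast Finset.mem_range.1 hj
    rw [hg]
    simp only
    rw [← Circle.exp_natCast_mul, ← dist_eq_norm]
    refine (hδa ?_).le
    rw [dist_zero_right, Real.norm_of_nonneg (by positivity)]
    refine lt_of_lt_of_le' hmδ ?_
    rw [le_div_iff₀ hm0]
    push_cast
    rw [mul_div_assoc', div_mul_eq_mul_div, div_le_iff₀ (by positivity)]
    have : (j : ℝ) * (2 * Real.pi * m) ≤ K * (2 * Real.pi * m) :=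
      mul_le_mul_of_nonneg_right hj'.le (by positivity)
    linarith
  have h1 : K * (‖a‖ / 2) ≤ ‖∑ j ∈ Finset.range K, g j‖ := by
    have h2 : ‖(K : ℝ) • a - ∑ j ∈ Finset.range K, g j‖ ≤ K * (‖a‖ / 2) := by
      have : (K : ℝ) • a - ∑ j ∈ Finset.range K, g j = -∑ j ∈ Finset.range K, (g j - a) := by
        rw [Finset.sum_sub_distrib, Finset.sum_const, Finset.card_range, Nat.cast_smul_eq_nsmul]
        abel
      rw [this, norm_neg]
      refine (norm_sum_le _ _).trans ((Finset.sum_le_sum hclose).trans ?_)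
      simp
    have h3 := norm_sub_norm_le ((K : ℝ) • a) (∑ j ∈ Finset.range K, g j)
    rw [norm_smul, Real.norm_of_nonneg hK0.le] at h3
    linarith
  have h4 : ‖∑ j ∈ Finset.range K, g j‖ ≤ ‖∑ j ∈ Finset.range (m * K), g j‖ := by
    refine CStarAlgebra.norm_le_norm_of_nonneg_of_le (Finset.sum_nonneg fun j _ => hpos _) ?_
    refine Finset.sum_le_sum_of_subset_of_nonneg ?_ fun j _ _ => hpos _
    exact Finset.range_mono (Nat.le_mul_of_pos_left _ (by exact_mod_cast hm0))
  rw [gaugeAverage_apply, norm_smul, norm_inv, Complex.norm_natCast]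
  rw [inv_mul_eq_div, le_div_iff₀ (by exact_mod_cast Nat.mul_pos (by exact_mod_cast hm0) hK)]
  refine le_trans (le_of_eq ?_) (h1.trans h4)
  push_cast
  field_simp

namespace LabelledGraph.Representation

variable {V : Type u} {E : Type w} {𝒜 : Type v} {G : LabelledGraph V E 𝒜}
  (ρ : G.Representation B) {htop : Set.univ ∈ G.smallestAcc} (hone : ρ.p ⟨Set.univ, htop⟩ = 1)
  {γ : Circle → B →⋆ₙₐ[ℂ] B} (hγs : ∀ z a, γ z (ρ.s a) = (z : ℂ) • ρ.s a)
  (hγp : ∀ z C, γ z (ρ.p C) = ρ.p C)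

include hγs hγp

/-- The gauge action is pointwise norm continuous. -/
theorem tendsto_gauge
    (hd : Dense (NonUnitalStarAlgebra.adjoin ℂ (Set.range ρ.p ∪ Set.range ρ.s) : Set B)) (a : B) :
    Filter.Tendsto (fun z => γ z a) (nhds 1) (nhds a) := by
  have h1 : ∀ b ∈ NonUnitalStarAlgebra.adjoin ℂ (Set.range ρ.p ∪ Set.range ρ.s),
      Filter.Tendsto (fun z => γ z b) (nhds 1) (nhds b) := by
    intro b hb
    induction hb using NonUnitalStarAlgebra.adjoin_induction with
    | mem x hx =>
      rcases hx with ⟨C, rfl⟩ | ⟨a, rfl⟩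
      · simp only [hγp]
        exact tendsto_const_nhds
      · simp only [hγs]
        have : Continuous fun z : Circle => (z : ℂ) • ρ.s a := by fun_prop
        simpa using this.tendsto 1
    | add x y _ _ hx hy => simpa only [map_add] using hx.add hy
    | zero => simpa only [map_zero] using tendsto_const_nhds
    | mul x y _ _ hx hy => simpa only [map_mul] using hx.mul hy
    | smul c x _ hx => simpa only [map_smul] using hx.const_smul c
    | star x _ hx => simpa only [map_star] using hx.star
  rw [Metric.tendsto_nhds]
  intro ε hε
  obtain ⟨b, hb, hab⟩ := Metric.dense_iff.1 hd a (ε / 3) (by positivity)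
  filter_upwards [Metric.tendsto_nhds.1 (h1 _ hab) (ε / 3) (by positivity)] with z hz
  have h2 : dist (γ z a) (γ z b) ≤ dist a b := by
    rw [dist_eq_norm, dist_eq_norm, ← map_sub]
    exact NonUnitalStarAlgHom.norm_apply_le _ _
  have h3 : dist b a < ε / 3 := hb
  have h4 := dist_triangle4 (γ z a) (γ z b) b a
  rw [dist_comm a b] at h2
  linarith

include hone

theorem gauge_word (z : Circle) (μ : List 𝒜) :
    γ z (ρ.word μ) = (z : ℂ) ^ μ.length • ρ.word μ := by
  induction μ with
  | nil => simp [← hone, hγp]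
  | cons a μ ih =>
    rw [word_cons, map_mul, hγs, ih, smul_mul_smul_comm, List.length_cons, pow_succ']

theorem gauge_mono (z : Circle) (μ : List 𝒜) (C : G.smallestAcc) (ν : List 𝒜) :
    γ z (ρ.mono μ C ν) = ((z : ℂ) ^ μ.length * star (z : ℂ) ^ ν.length) • ρ.mono μ C ν := by
  rw [mono, map_mul, map_mul, map_star, ρ.gauge_word hone hγs hγp, ρ.gauge_word hone hγs hγp, hγp,
    star_smul, smul_mul_assoc, smul_mul_smul_comm, star_pow]

theorem gaugeAverage_of_mem_coreSpan {b : B} (hb : b ∈ ρ.coreSpan) {n : ℕ} (hn : 0 < n) :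
    gaugeAverage γ n b = b := by
  induction hb using Submodule.span_induction with
  | mem x hx =>
    obtain ⟨μ, C, ν, h, rfl⟩ := hx
    rw [gaugeAverage_apply]
    have h1 : ∀ z : Circle, γ z (ρ.mono μ C ν) = ρ.mono μ C ν := by
      intro z
      have h2 : (z : ℂ) * star (z : ℂ) = 1 := by
        rw [Complex.star_def, Complex.mul_conj, Complex.normSq_eq_norm_sq, Circle.norm_coe]
        simp
      rw [ρ.gauge_mono hone hγs hγp, h, ← mul_pow, h2, one_pow, one_smul]
    simp only [h1, Finset.sum_const, Finset.card_range]
    rw [← Nat.cast_smul_eq_nsmul ℂ, smul_smul, inv_mul_cancel₀ (by exact_mod_cast hn.ne'), one_smul]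
  | zero => simp
  | add x y _ _ hx hy => rw [map_add, hx, hy]
  | smul c x _ hx => rw [map_smul, hx]

theorem eventually_gaugeAverage_of_mem_offSpan {x : B} (hx : x ∈ ρ.offSpan) :
    ∀ᶠ n in Filter.atTop, gaugeAverage γ n x = 0 := by
  induction hx using Submodule.span_induction with
  | mem x hx =>
    obtain ⟨μ, C, ν, h, rfl⟩ := hx
    filter_upwards [Filter.eventually_gt_atTop (μ.length + ν.length)] with n hn
    set ζ : Circle := Circle.exp (2 * Real.pi / n) with hζ
    have hprim : IsPrimitiveRoot (ζ : ℂ) n := by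
      have := Complex.isPrimitiveRoot_exp n (by omega)
      rw [hζ, Circle.coe_exp]
      convert this using 2
      push_cast
      ring
    have hstar : (ζ : ℂ) * star (ζ : ℂ) = 1 := by
      rw [Complex.star_def, Complex.mul_conj, Complex.normSq_eq_norm_sq, Circle.norm_coe]
      simp
    set q : ℂ := (ζ : ℂ) ^ μ.length * star (ζ : ℂ) ^ ν.length with hq
    have hq1 : q ≠ 1 := by
      intro h1
      have h2 : (ζ : ℂ) ^ μ.length = (ζ : ℂ) ^ ν.length := by
        calc (ζ : ℂ) ^ μ.length
            = (ζ : ℂ) ^ μ.length * ((ζ : ℂ) * star (ζ : ℂ)) ^ ν.length := by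
              rw [hstar, one_pow, mul_one]
          _ = q * (ζ : ℂ) ^ ν.length := by rw [hq, mul_pow]; ring
          _ = _ := by rw [h1, one_mul]
      exact h (hprim.pow_inj (by omega) (by omega) h2)
    have hqn : q ^ n = 1 := by
      rw [hq, mul_pow, ← pow_mul, ← pow_mul, mul_comm, mul_comm ν.length, mul_comm μ.length,
        pow_mul, pow_mul, ← star_pow, hprim.pow_eq_one]
      simp
    have hgeom : ∑ j ∈ Finset.range n, q ^ j = 0 := by
      have := geom_sum_mul q n
      rw [hqn, sub_self] at this
      exact (mul_eq_zero.1 this).resolve_right (sub_ne_zero.2 hq1)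
    rw [gaugeAverage_apply, ← hζ]
    have h1 : ∀ j, γ (ζ ^ j) (ρ.mono μ C ν) = q ^ j • ρ.mono μ C ν := by
      intro j
      rw [ρ.gauge_mono hone hγs hγp, hq, mul_pow, Circle.coe_pow, star_pow, ← pow_mul, ← pow_mul,
        ← pow_mul, ← pow_mul, mul_comm j, mul_comm j]
    simp only [h1, ← Finset.sum_smul, hgeom, zero_smul, smul_zero]
  | zero => exact .of_forall fun n => map_zero _
  | add x y _ _ hx hy =>
    filter_upwards [hx, hy] with n hx hy
    rw [map_add, hx, hy, add_zero]
  | smul c x _ hx =>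
    filter_upwards [hx] with n hx
    rw [map_smul, hx, smul_zero]

end LabelledGraph.Representation

end Gauge

/-! ### Simplicity and pure infiniteness from compressions to the unit -/

section Abstract

variable {A : Type*} [CStarAlgebra A]

/-- A positive element close to a large scalar can be compressed to the unit. -/
theorem exists_star_mul_mul_eq_one_of_norm_lt {h : A} {θ : ℝ}
    (hθ : ‖star h * h - (θ : ℂ) • 1‖ < |θ|) : ∃ r : A, star r * (star h * h) * r = 1 := by
  let _ := CStarAlgebra.spectralOrder A
  have _ := CStarAlgebra.spectralOrderedRing A
  have hθ0 : (θ : ℂ) ≠ 0 := by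
    intro h0
    have : θ = 0 := by exact_mod_cast h0
    rw [this, abs_zero] at hθ
    exact absurd hθ (norm_nonneg _).not_gt
  have hunit : IsUnit (star h * h) := by
    have h1 : ‖(1 : A) - (θ : ℂ)⁻¹ • (star h * h)‖ < 1 := by
      have : (1 : A) - (θ : ℂ)⁻¹ • (star h * h) =
          -((θ : ℂ)⁻¹ • (star h * h - (θ : ℂ) • 1)) := by
        rw [smul_sub, smul_smul, inv_mul_cancel₀ hθ0, one_smul, neg_sub]
      rw [this, norm_neg, norm_smul, norm_inv, Complex.norm_real, Real.norm_eq_abs,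
        inv_mul_lt_iff₀ (lt_of_le_of_lt (norm_nonneg _) hθ), mul_one]
      exact hθ
    have h2 := isUnit_one_sub_of_norm_lt_one h1
    rw [sub_sub_cancel] at h2
    have h3 := h2.smul (Units.mk0 (θ : ℂ) hθ0)
    rwa [Units.smul_def, Units.val_mk0, smul_smul, mul_inv_cancel₀ hθ0, one_smul] at h3
  have hpos : 0 ≤ star h * h := star_mul_self_nonneg h
  set q := CFC.sqrt (star h * h) with hq
  have hqq : q * q = star h * h := CFC.sqrt_mul_sqrt_self _ hpos
  have hqs : star q = q := (IsSelfAdjoint.of_nonneg (CFC.sqrt_nonneg (star h * h))).star_eq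
  obtain ⟨r, hr⟩ := (CFC.isUnit_sqrt_iff (star h * h) hpos).2 hunit
  rw [← hq] at hr
  refine ⟨((r⁻¹ : Aˣ) : A), ?_⟩
  have h1 : star ((r⁻¹ : Aˣ) : A) = ((r⁻¹ : Aˣ) : A) := by
    rw [← Units.coe_star_inv]
    congr 1
    rw [inv_inj]
    ext
    rw [Units.coe_star, hr, hqs]
  rw [h1, ← hqq, ← hr, ← mul_assoc, Units.inv_mul, one_mul, Units.mul_inv]

theorem isSimpleCStar_of_compression [Nontrivial A]
    (H : ∀ h : A, h ≠ 0 → ∃ x : A, star x * (star h * h) * x = 1) : IsSimpleCStar A := by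
  refine ⟨inferInstance, fun I _ => ?_⟩
  by_cases hI : ∃ h ∈ I, h ≠ 0
  · right
    obtain ⟨h, hh, h0⟩ := hI
    obtain ⟨x, hx⟩ := H h h0
    rw [eq_top_iff]
    intro y _
    have h1 : (1 : A) ∈ I := by
      rw [← hx]
      exact I.mul_mem_right _ _ (I.mul_mem_left _ _ (I.mul_mem_left _ _ hh))
    simpa using I.mul_mem_left y 1 h1
  · left
    push Not at hI
    rw [eq_bot_iff]
    intro y hy
    rw [TwoSidedIdeal.mem_bot]
    exact hI y hy

/-- If nonzero positive elements compress to the unit and the unit is infinite, then every nonzero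
hereditary subalgebra contains a projection equivalent to the unit, and this projection is
infinite. -/
theorem isPurelyInfiniteCStar_of_compression
    (H : ∀ h : A, h ≠ 0 → ∃ x : A, star x * (star h * h) * x = 1)
    {t : A} (ht : star t * t = 1) (ht' : t * star t ≠ 1) : IsPurelyInfiniteCStar A := by
  let _ := CStarAlgebra.spectralOrder A
  have _ := CStarAlgebra.spectralOrderedRing A
  intro K hK hK0
  obtain ⟨h, hh, h0⟩ : ∃ h ∈ K, h ≠ 0 := by
    by_contra hcon
    push Not at hcon
    refine hK0 (eq_bot_iff.2 fun y hy => ?_)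
    rw [hcon y hy]
    exact zero_mem _
  obtain ⟨x, hx⟩ := H (star h) (star_ne_zero.2 h0)
  rw [star_star] at hx
  set u := star h * x with hu
  have huu : star u * u = 1 := by
    rw [hu, star_mul, star_star, ← hx]
    simp only [mul_assoc]
  have hp : IsStarProjection (u * star u) := by
    refine ⟨?_, ?_⟩
    · change u * star u * (u * star u) = u * star u
      rw [mul_assoc, ← mul_assoc (star u), huu, one_mul]
    · change star (u * star u) = u * star u
      simp
  refine ⟨u * star u, ?_, hp, u * t * star u, ?_, ?_, ?_⟩
  · -- `u u* = h* x x* h` is dominated by `‖x‖² h* h`.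
    refine hK.2 (((‖x‖ ^ 2 : ℝ) : ℂ) • (star h * h))
      (SMulMemClass.smul_mem _ (mul_mem (star_mem hh) hh)) _ ⟨star u, by rw [star_star]⟩ ?_
    have h1 : 0 ≤ algebraMap ℝ A (‖x‖ ^ 2) - x * star x :=
      sub_nonneg.2 CStarAlgebra.mul_star_le_algebraMap_norm_sq
    obtain ⟨d, hd⟩ := CStarAlgebra.nonneg_iff_eq_star_mul_self.1 h1
    refine ⟨d * h, ?_⟩
    calc _ = star h * (algebraMap ℝ A (‖x‖ ^ 2) - x * star x) * h := by
          rw [hu, Algebra.algebraMap_eq_smul_one, mul_sub, sub_mul, Complex.coe_smul]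
          simp [mul_assoc]
      _ = _ := by rw [hd]; simp [mul_assoc]
  · calc _ = u * star t * (star u * u) * t * star u := by simp [mul_assoc]
      _ = u * (star t * t) * star u := by rw [huu, mul_one, mul_assoc u]
      _ = _ := by rw [ht, mul_one]
  · calc _ = u * (star u * u) * t * star u * star (u * t * star u) := by simp only [mul_assoc]
      _ = _ := by rw [huu, mul_one]
  · intro h1
    apply ht'
    calc t * star t = (star u * u) * t * (star u * u) * star t * (star u * u) := by
          simp only [huu, mul_one, one_mul]
      _ = star u * (u * t * star u * star (u * t * star u)) * u := by simp [mul_assoc]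
      _ = (star u * u) * (star u * u) := by rw [h1]; simp only [mul_assoc]
      _ = 1 := by rw [huu, mul_one]

end Abstract

namespace NaryTree

open LabelledGraph LabelledGraph.Representation

variable {N : ℕ} {V : Type u} {T : NaryTree N V} {A : Type*} [CStarAlgebra A] [Nontrivial A]
  (ρ : T.dyckGraph.Representation A) (hN : 1 ≤ N) (hone : ρ.p ⟨Set.univ, T.univ_mem hN⟩ = 1)
  {γ : Circle → A →⋆ₙₐ[ℂ] A} (hγs : ∀ z a, γ z (ρ.s a) = (z : ℂ) • ρ.s a)
  (hγp : ∀ z C, γ z (ρ.p C) = ρ.p C)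
  (hd : Dense (NonUnitalStarAlgebra.adjoin ℂ (Set.range ρ.p ∪ Set.range ρ.s) : Set A))

include hone hγs hγp hd

/-- In a representation with gauge action that generates the algebra, every nonzero positive
element compresses to the unit. -/
theorem exists_star_mul_mul_eq_one {h : A} (hh : h ≠ 0) :
    ∃ x : A, star x * (star h * h) * x = 1 := by
  obtain ⟨c, hc, m, hm, hK⟩ := exists_le_norm_gaugeAverage γ hh
    (ρ.tendsto_gauge hγs hγp hd (star h * h))
  obtain ⟨b, hab, hb⟩ := Metric.dense_iff.1 hd (star h * h) (c / 4) (by positivity)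
  rw [Metric.mem_ball, dist_comm, dist_eq_norm] at hab
  obtain ⟨b₀, hb₀, x, hx, rfl⟩ := Submodule.mem_sup.1 (ρ.adjoin_le_span hone hb)
  -- Symmetrize, so that the core part becomes self-adjoint.
  set b₁ := (2⁻¹ : ℂ) • (b₀ + star b₀) with hb₁
  set x₁ := (2⁻¹ : ℂ) • (x + star x) with hx₁
  have hb₁mem : b₁ ∈ ρ.coreSpan :=
    Submodule.smul_mem _ _ (add_mem hb₀ (ρ.star_mem_coreSpan hb₀))
  have hx₁mem : x₁ ∈ ρ.offSpan := Submodule.smul_mem _ _ (add_mem hx (ρ.star_mem_offSpan hx))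
  have hb₁s : IsSelfAdjoint b₁ := by
    rw [IsSelfAdjoint, hb₁, star_smul, star_add, star_star, add_comm (star b₀)]
    simp
  have hclose : ‖star h * h - (b₁ + x₁)‖ ≤ c / 4 := by
    have h1 : star h * h - (b₁ + x₁) =
        (2⁻¹ : ℂ) • ((star h * h - (b₀ + x)) + star (star h * h - (b₀ + x))) := by
      simp only [hb₁, hx₁, star_sub, star_mul, star_star, star_add]
      module
    rw [h1, norm_smul]
    have h2 := norm_add_le (star h * h - (b₀ + x)) (star (star h * h - (b₀ + x)))
    rw [norm_star] at h2
    have h3 : ‖(2⁻¹ : ℂ)‖ = 2⁻¹ := by simp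
    rw [h3]
    linarith
  obtain ⟨K, hKx, hK0⟩ : ∃ K, gaugeAverage γ (m * K) x₁ = 0 ∧ 0 < K := by
    obtain ⟨n, hn⟩ := Filter.eventually_atTop.1
      (ρ.eventually_gaugeAverage_of_mem_offSpan hone hγs hγp hx₁mem)
    exact ⟨n + 1, hn _ (by nlinarith), by omega⟩
  have hnorm : 3 * c / 4 ≤ ‖b₁‖ := by
    have h1 := hK K hK0
    have h2 := norm_gaugeAverage_le γ (m * K) (star h * h - (b₁ + x₁))
    rw [map_sub, map_add, hKx, add_zero,
      ρ.gaugeAverage_of_mem_coreSpan hone hγs hγp hb₁mem (Nat.mul_pos hm hK0)] at h2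
    have h3 := norm_sub_norm_le (gaugeAverage γ (m * K) (star h * h)) b₁
    linarith
  obtain ⟨y, θ, hy, hθ, hyθ⟩ := exists_isometry_compression ρ hN hone hb₁mem hb₁s hx₁mem
  have hynorm : ‖y‖ = 1 := by
    have h1 := CStarRing.norm_star_mul_self (x := y)
    rw [hy, CStarRing.norm_one] at h1
    nlinarith [norm_nonneg y]
  obtain ⟨r, hr⟩ := exists_star_mul_mul_eq_one_of_norm_lt (h := h * y) (θ := θ) (by
    have h1 : star (h * y) * (h * y) - (θ : ℂ) • 1 =
        star y * (star h * h - (b₁ + x₁)) * y := by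
      rw [mul_sub, sub_mul, hyθ]
      simp [mul_assoc]
    rw [h1]
    calc _ ≤ ‖star y‖ * ‖star h * h - (b₁ + x₁)‖ * ‖y‖ :=
          (norm_mul_le _ _).trans (mul_le_mul_of_nonneg_right (norm_mul_le _ _) (norm_nonneg _))
      _ = ‖star h * h - (b₁ + x₁)‖ := by rw [norm_star, hynorm, one_mul, mul_one]
      _ < |θ| := by linarith)
  refine ⟨y * r, ?_⟩
  rw [← hr]
  simp [mul_assoc]

theorem isSimpleCStar_and_isPurelyInfiniteCStar :
    IsSimpleCStar A ∧ IsPurelyInfiniteCStar A := by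
  have H := fun (h : A) (hh : h ≠ 0) => exists_star_mul_mul_eq_one ρ hN hone hγs hγp hd hh
  refine ⟨isSimpleCStar_of_compression H, ?_⟩
  -- The isometry `s_β` is not unitary, its range being orthogonal to that of `s_α`.
  have hβ : star (ρ.s (.closing ⟨0, hN⟩)) * ρ.s (.closing ⟨0, hN⟩) = 1 := by
    rw [ρ.star_s_mul_s, ← hone]
    congr 1
    refine Subtype.ext ?_
    change T.dyckGraph.relRange Set.univ _ = _
    rw [T.relRange_closing]
    simp
  refine isPurelyInfiniteCStar_of_compression H hβ fun h1 => ?_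
  have h2 : star (ρ.s (.opening ⟨0, hN⟩)) = 0 := by
    rw [← mul_one (star _), ← h1, ← mul_assoc, ρ.star_s_mul_s_of_ne _ _ (by simp), zero_mul]
  have h3 := star_word_mul_p_cylinder_mul_word ρ hN hone (fun _ : Fin 0 => ⟨0, hN⟩) ⟨0, hN⟩ 1
  rw [star_eq_zero] at h2
  simp [h2] at h3

end NaryTree

/-! ### The gauge action and the unit of the universal algebra -/

/-- The C*-algebra structure on a C*-algebra that has a unit `e`. -/
noncomputable abbrev CStarAlgebra.ofUnit {A : Type*} [NonUnitalCStarAlgebra A] (e : A)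
    (h₁ : ∀ x, e * x = x) (h₂ : ∀ x, x * e = x) : CStarAlgebra A :=
  letI ring : NormedRing A :=
    { (inferInstance : NonUnitalNormedRing A) with
      one := e
      one_mul := h₁
      mul_one := h₂ }
  letI alg : Algebra ℂ A := Algebra.ofModule (smul_mul_assoc) (mul_smul_comm)
  { ring with
    toStarRing := inferInstance
    toCompleteSpace := inferInstance
    toCStarRing := inferInstance
    toNormedAlgebra := { alg with norm_smul_le := norm_smul_le }
    toStarModule := inferInstance }

namespace LabelledGraph

variable {V : Type u} {E : Type w} {𝒜 : Type v} (G : LabelledGraph V E 𝒜)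

variable {G} in
/-- The representation with all partial isometries multiplied by a scalar of modulus one. -/
def Representation.gauge {B : Type*} [NonUnitalCStarAlgebra B] (ρ : G.Representation B)
    (z : Circle) : G.Representation B :=
  have hz : (z : ℂ) * star (z : ℂ) = 1 := by
    rw [Complex.star_def, Complex.mul_conj, Complex.normSq_eq_norm_sq, Circle.norm_coe]
    simp
  have hz' : star (z : ℂ) * (z : ℂ) = 1 := by rw [mul_comm, hz]
  { p := ρ.p
    s := fun a => (z : ℂ) • ρ.s a
    isStarProjection_p := ρ.isStarProjection_p
    partialIsometry_s := fun a => by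
      rw [star_smul, smul_mul_smul_comm, hz, one_smul, mul_smul_comm, ρ.partialIsometry_s]
    p_empty := ρ.p_empty
    p_inter := ρ.p_inter
    p_union := ρ.p_union
    p_mul_s := fun A a => by rw [mul_smul_comm, ρ.p_mul_s, smul_mul_assoc]
    star_s_mul_s := fun a => by
      rw [star_smul, smul_mul_smul_comm, hz', one_smul, ρ.star_s_mul_s]
    star_s_mul_s_of_ne := fun a b h => by
      rw [star_smul, smul_mul_smul_comm, ρ.star_s_mul_s_of_ne a b h, smul_zero]
    p_eq_sum := fun A hA => by
      rw [ρ.p_eq_sum A hA]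
      refine Finset.sum_congr rfl fun a _ => ?_
      rw [star_smul, smul_mul_assoc, smul_mul_smul_comm, hz, one_smul] }

variable {G} in
/-- The action of the circle on the representations. -/
def RepIndex.gauge (z : Circle) (i : G.RepIndex) : G.RepIndex where
  alg := i.alg
  rep := i.rep.gauge z

/-- The gauge action on the product of all representations permutes the factors. -/
noncomputable def gaugeLp (z : Circle) :
    lp (fun i : G.RepIndex => i.alg) ∞ →⋆ₙₐ[ℂ] lp (fun i : G.RepIndex => i.alg) ∞ where
  toFun x := ⟨fun i => (x (i.gauge z) : i.alg), memℓp_infty ⟨‖x‖, by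
    rintro _ ⟨i, rfl⟩
    exact lp.norm_apply_le_norm ENNReal.top_ne_zero x (i.gauge z)⟩⟩
  map_smul' _ _ := rfl
  map_zero' := rfl
  map_add' _ _ := rfl
  map_mul' _ _ := rfl
  map_star' _ := rfl

theorem gaugeLp_mem (z : Circle) {x : lp (fun i : G.RepIndex => i.alg) ∞}
    (hx : x ∈ G.cstarSubalgebra) : G.gaugeLp z x ∈ G.cstarSubalgebra := by
  have hcont : Continuous (G.gaugeLp z) :=
    AddMonoidHomClass.continuous_of_bound (G.gaugeLp z) 1 fun x => by
      rw [one_mul]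
      exact NonUnitalStarAlgHom.norm_apply_le _ x
  have hle : NonUnitalStarAlgebra.adjoin ℂ (Set.range G.prodP ∪ Set.range G.prodS) ≤
      G.cstarSubalgebra.comap (G.gaugeLp z) := by
    refine NonUnitalStarAlgebra.adjoin_le ?_
    rintro _ (⟨A, rfl⟩ | ⟨a, rfl⟩)
    · exact (G.genP A).2
    · exact SMulMemClass.smul_mem (z : ℂ) (G.genS a).2
  have hclosed : IsClosed (G.cstarSubalgebra : Set (lp (fun i : G.RepIndex => i.alg) ∞)) :=
    NonUnitalStarSubalgebra.isClosed_topologicalClosure _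
  exact closure_minimal hle (hclosed.preimage hcont) hx

/-- The gauge action on the universal algebra: it fixes the projections `p_A` and multiplies the
partial isometries `s_a` by `z`. -/
noncomputable def gaugeHom (z : Circle) : G.CStar →⋆ₙₐ[ℂ] G.CStar where
  toFun x := ⟨G.gaugeLp z x.1, G.gaugeLp_mem z x.2⟩
  map_smul' c x := Subtype.ext (map_smul (G.gaugeLp z) c x.1)
  map_zero' := Subtype.ext (map_zero (G.gaugeLp z))
  map_add' x y := Subtype.ext (map_add (G.gaugeLp z) x.1 y.1)
  map_mul' x y := Subtype.ext (map_mul (G.gaugeLp z) x.1 y.1)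
  map_star' x := Subtype.ext (map_star (G.gaugeLp z) x.1)

theorem dense_adjoin_universalRep :
    Dense (NonUnitalStarAlgebra.adjoin ℂ
      (Set.range G.universalRep.p ∪ Set.range G.universalRep.s) : Set G.CStar) := by
  have key : ∀ x ∈ NonUnitalStarAlgebra.adjoin ℂ (Set.range G.prodP ∪ Set.range G.prodS),
      ∀ hx : x ∈ G.cstarSubalgebra, (show G.CStar from ⟨x, hx⟩) ∈ NonUnitalStarAlgebra.adjoin ℂ
        (Set.range G.universalRep.p ∪ Set.range G.universalRep.s) := by
    have hmem : ∀ x ∈ NonUnitalStarAlgebra.adjoin ℂ (Set.range G.prodP ∪ Set.range G.prodS),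
        x ∈ G.cstarSubalgebra := fun x hx => NonUnitalStarSubalgebra.le_topologicalClosure _ hx
    intro x hx
    induction hx using NonUnitalStarAlgebra.adjoin_induction with
    | mem x hx =>
      intro _
      rcases hx with ⟨A, rfl⟩ | ⟨a, rfl⟩
      · exact NonUnitalStarAlgebra.subset_adjoin ℂ _ (.inl ⟨A, rfl⟩)
      · exact NonUnitalStarAlgebra.subset_adjoin ℂ _ (.inr ⟨a, rfl⟩)
    | add x y hx hy ihx ihy => exact fun _ => add_mem (ihx (hmem _ hx)) (ihy (hmem _ hy))
    | zero => exact fun _ => zero_mem _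
    | mul x y hx hy ihx ihy => exact fun _ => mul_mem (ihx (hmem _ hx)) (ihy (hmem _ hy))
    | smul c x hx ihx => exact fun _ => SMulMemClass.smul_mem c (ihx (hmem _ hx))
    | star x hx ihx => exact fun _ => star_mem (ihx (hmem _ hx))
  intro x
  refine closure_subtype.2 (closure_mono ?_ x.2)
  intro y hy
  exact ⟨⟨y, NonUnitalStarSubalgebra.le_topologicalClosure _ hy⟩, key y hy _, rfl⟩

theorem genP_univ_mul_and_mul_genP_univ (htop : Set.univ ∈ G.smallestAcc) (x : G.CStar) :
    G.universalRep.p ⟨Set.univ, htop⟩ * x = x ∧ x * G.universalRep.p ⟨Set.univ, htop⟩ = x := by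
  set ρ := G.universalRep with hρ
  set e := ρ.p ⟨Set.univ, htop⟩ with he
  have hpe : ∀ A, ρ.p A * e = ρ.p A := fun A => by
    rw [he, ρ.p_inter]
    congr 1
    exact Subtype.ext (Set.inter_univ _)
  have hep : ∀ A, e * ρ.p A = ρ.p A := fun A => by
    rw [he, ρ.p_inter]
    congr 1
    exact Subtype.ext (Set.univ_inter _)
  have hes : star e = e := (ρ.isStarProjection_p _).isSelfAdjoint.star_eq
  have hadj : ∀ y ∈ NonUnitalStarAlgebra.adjoin ℂ (Set.range ρ.p ∪ Set.range ρ.s),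
      e * y = y ∧ y * e = y := by
    intro y hy
    induction hy using NonUnitalStarAlgebra.adjoin_induction with
    | mem y hy =>
      rcases hy with ⟨A, rfl⟩ | ⟨a, rfl⟩
      · exact ⟨hep A, hpe A⟩
      · have hs : ρ.s a = ρ.s a * ρ.p ⟨G.range [a], range_mem [a]⟩ := by
          rw [← ρ.star_s_mul_s, ← mul_assoc, ρ.partialIsometry_s]
        refine ⟨?_, ?_⟩
        · rw [he, ρ.p_mul_s]
          exact hs.symm
        · rw [hs, mul_assoc, hpe]
    | add y z _ _ hy hz =>
      rw [mul_add, add_mul, hy.1, hy.2, hz.1, hz.2]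
      exact ⟨rfl, rfl⟩
    | zero => simp
    | mul y z _ _ hy hz =>
      rw [← mul_assoc, hy.1, mul_assoc, hz.2]
      exact ⟨rfl, rfl⟩
    | smul c y _ hy =>
      rw [mul_smul_comm, smul_mul_assoc, hy.1, hy.2]
      exact ⟨rfl, rfl⟩
    | star y _ hy =>
      have h1 := congrArg star hy.1
      have h2 := congrArg star hy.2
      rw [star_mul, hes] at h1 h2
      exact ⟨h2, h1⟩
  have hclosed : IsClosed {y : G.CStar | e * y = y ∧ y * e = y} :=
    (isClosed_eq (continuous_const.mul continuous_id) continuous_id).inter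
      (isClosed_eq (continuous_id.mul continuous_const) continuous_id)
  exact closure_minimal hadj hclosed (G.dense_adjoin_universalRep x)

end LabelledGraph

open LabelledGraph in
/-- The universal algebra of the Dyck graph is simple and purely infinite as soon as it is
nonzero. -/
theorem NaryTree.isSimpleCStar_and_isPurelyInfiniteCStar_cstar {N : ℕ} (hN : 1 ≤ N) {V : Type u}
    (T : NaryTree N V) [Nontrivial T.dyckGraph.CStar] :
    IsSimpleCStar T.dyckGraph.CStar ∧ IsPurelyInfiniteCStar T.dyckGraph.CStar := by
  have hunit := T.dyckGraph.genP_univ_mul_and_mul_genP_univ (T.univ_mem hN)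
  let _ := CStarAlgebra.ofUnit (T.dyckGraph.universalRep.p ⟨Set.univ, T.univ_mem hN⟩)
    (fun x => (hunit x).1) (fun x => (hunit x).2)
  exact NaryTree.isSimpleCStar_and_isPurelyInfiniteCStar T.dyckGraph.universalRep hN rfl
    (γ := T.dyckGraph.gaugeHom) (fun _ _ => rfl) (fun _ _ => rfl)
    T.dyckGraph.dense_adjoin_universalRep

/-! ### A nonzero representation of the Dyck graph -/

section PartialEquivOperator

variable {X : Type u}

theorem PartialEquiv.summable_indicator_comp (e : PartialEquiv X X) {g : X → ℝ}
    (hg : Summable g) : Summable (e.source.indicator fun x => g (e x)) :=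
  summable_subtype_iff_indicator.1 (hg.comp_injective (i := fun x : e.source => e x)
    fun x y h => Subtype.ext (e.injOn x.2 y.2 h))

open Classical in
/-- The operator on `ℓ²(X)` that composes functions with a partial bijection of `X` and extends
them by zero. -/
noncomputable def PartialEquiv.toOperator (e : PartialEquiv X X) :
    lp (fun _ : X => ℂ) 2 →L[ℂ] lp (fun _ : X => ℂ) 2 :=
  have key : ∀ f : lp (fun _ : X => ℂ) 2,
      (fun x => ‖if x ∈ e.source then f (e x) else 0‖ ^ (2 : ℝ≥0∞).toReal) =
        e.source.indicator fun x => ‖f (e x)‖ ^ (2 : ℝ≥0∞).toReal := fun f => by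
    ext x
    by_cases hx : x ∈ e.source <;> simp [hx]
  have hsum : ∀ f : lp (fun _ : X => ℂ) 2, Summable fun x => ‖f x‖ ^ (2 : ℝ≥0∞).toReal :=
    fun f => (lp.memℓp f).summable (by simp)
  LinearMap.mkContinuous
    { toFun := fun f => ⟨fun x => if x ∈ e.source then f (e x) else 0, memℓp_gen (by
        rw [key f]
        exact e.summable_indicator_comp (hsum f))⟩
      map_add' := fun f g => by
        ext x
        change (if x ∈ e.source then (f + g) (e x) else 0) =
          (if x ∈ e.source then f (e x) else 0) + if x ∈ e.source then g (e x) else 0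
        by_cases hx : x ∈ e.source <;> simp [hx]
      map_smul' := fun c f => by
        ext x
        by_cases hx : x ∈ e.source <;> simp [hx] } 1 fun f => by
    rw [one_mul]
    refine lp.norm_le_of_tsum_le (by simp) (norm_nonneg _) ?_
    rw [lp.norm_rpow_eq_tsum (by simp) f]
    change ∑' x, ‖if x ∈ e.source then f (e x) else 0‖ ^ (2 : ℝ≥0∞).toReal ≤ _
    rw [key f, ← tsum_subtype]
    exact ((hsum f).comp_injective (i := fun x : e.source => e x)
      fun x y h => Subtype.ext (e.injOn x.2 y.2 h)).tsum_le_tsum_of_inj (fun x => e x)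
      (fun x y h => Subtype.ext (e.injOn x.2 y.2 h)) (fun _ _ => by positivity)
      (fun _ => le_rfl) (hsum f)

open Classical in
theorem PartialEquiv.toOperator_apply (e : PartialEquiv X X) (f : lp (fun _ : X => ℂ) 2) (x : X) :
    e.toOperator f x = if x ∈ e.source then f (e x) else 0 := rfl

theorem PartialEquiv.star_toOperator (e : PartialEquiv X X) :
    star e.toOperator = e.symm.toOperator := by
  classical
  rw [ContinuousLinearMap.star_eq_adjoint, eq_comm, ContinuousLinearMap.eq_adjoint_iff]
  intro f g
  rw [lp.inner_eq_tsum, lp.inner_eq_tsum]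
  have h1 : (fun x => inner ℂ (e.symm.toOperator f x) (g x)) =
      e.target.indicator fun x => inner ℂ (f (e.symm x)) (g x) := by
    ext x
    by_cases hx : x ∈ e.target <;> simp [hx, toOperator_apply]
  have h2 : (fun x => inner ℂ (f x) (e.toOperator g x)) =
      e.source.indicator fun x => inner ℂ (f x) (g (e x)) := by
    ext x
    by_cases hx : x ∈ e.source <;> simp [hx, toOperator_apply]
  rw [h1, h2, ← tsum_subtype, ← tsum_subtype,
    ← e.toEquiv.tsum_eq fun x : e.target => inner ℂ (f (e.symm x)) (g x)]
  refine tsum_congr fun x => ?_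
  simp [PartialEquiv.toEquiv]

end PartialEquivOperator

namespace NaryTree

open LabelledGraph

variable {N : ℕ} {V : Type u} (T : NaryTree N V)

/-- The space of infinite paths of the Dyck graph, encoded without admissibility conditions: a path is
given by its first vertex and, for each step, the branch that it follows, with `none` for the step
to the parent. -/
abbrev DyckPath (_T : NaryTree N V) : Type u := V × (ℕ → Option (Fin N))

/-- The sequence of steps that starts with the step `o` and continues with `f`. -/
def consStep (o : Option (Fin N)) (f : ℕ → Option (Fin N)) : ℕ → Option (Fin N)
  | 0 => o
  | n + 1 => f n

/-- The partial bijection that removes the first edge, labelled `a`, from a path. -/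
noncomputable def pathShift : DyckLetter N → PartialEquiv T.DyckPath T.DyckPath
  | .opening i =>
    { toFun := fun x => (T.child x.1 i, fun n => x.2 (n + 1))
      invFun := fun y => (T.parent y.1, consStep (some i) y.2)
      source := {x | x.2 0 = some i}
      target := {y | T.branch y.1 = i}
      map_source' := fun x _ => T.branch_child _ _
      map_target' := fun y _ => rfl
      left_inv' := fun x hx => Prod.ext (T.parent_child _ _) (funext fun n => by
        cases n with
        | zero => exact hx.symm
        | succ n => rfl)
      right_inv' := by
        rintro y rfl
        exact Prod.ext (T.child_parent_branch _) rfl }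
  | .closing i =>
    { toFun := fun x => (T.parent x.1, fun n => x.2 (n + 1))
      invFun := fun y => (T.child y.1 i, consStep none y.2)
      source := {x | x.2 0 = none ∧ T.branch x.1 = i}
      target := Set.univ
      map_source' := fun _ _ => trivial
      map_target' := fun y _ => ⟨rfl, T.branch_child _ _⟩
      left_inv' := by
        rintro x ⟨hx, rfl⟩
        refine Prod.ext (T.child_parent_branch _) (funext fun n => ?_)
        cases n with
        | zero => exact hx.symm
        | succ n => rfl
      right_inv' := fun y _ => Prod.ext (T.parent_child _ _) rfl }

theorem pathShift_target (a : DyckLetter N) :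
    (T.pathShift a).target = {y | y.1 ∈ T.dyckGraph.range [a]} := by
  cases a with
  | opening i => ext y; simp [pathShift, range, relRange_opening]
  | closing i => ext y; simp [pathShift, range, relRange_closing]

theorem pathShift_mem_relRange {a : DyckLetter N} {x : T.DyckPath}
    (hx : x ∈ (T.pathShift a).source) (A : Set V) :
    (T.pathShift a x).1 ∈ T.dyckGraph.relRange A [a] ↔ x.1 ∈ A := by
  cases a with
  | opening i => simp [pathShift, relRange_opening]
  | closing i =>
    obtain ⟨-, rfl⟩ := hx
    simp [pathShift, relRange_closing]

theorem existsUnique_mem_pathShift_source (x : T.DyckPath) :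
    ∃! a, x ∈ (T.pathShift a).source := by
  rcases h : x.2 0 with _ | i
  · refine ⟨.closing (T.branch x.1), ⟨h, rfl⟩, ?_⟩
    rintro (j | j) hj
    · exact absurd (h.symm.trans hj) (by simp)
    · rw [hj.2]
  · refine ⟨.opening i, h, ?_⟩
    rintro (j | j) hj
    · rw [Option.some.inj (h.symm.trans hj)]
    · exact absurd (h.symm.trans hj.1) (by simp)

/-- The projection onto the functions supported on the paths that start in `A`. -/
noncomputable def pathProj (A : Set V) :
    lp (fun _ : T.DyckPath => ℂ) 2 →L[ℂ] lp (fun _ : T.DyckPath => ℂ) 2 :=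
  (PartialEquiv.ofSet {x : T.DyckPath | x.1 ∈ A}).toOperator

open Classical in
theorem pathProj_apply (A : Set V) (f : lp (fun _ : T.DyckPath => ℂ) 2) (x : T.DyckPath) :
    T.pathProj A f x = if x.1 ∈ A then f x else 0 := rfl

/-- The representation of the Dyck graph on the square summable functions on its path space. -/
noncomputable def pathRepresentation : T.dyckGraph.Representation
    (lp (fun _ : T.DyckPath => ℂ) 2 →L[ℂ] lp (fun _ : T.DyckPath => ℂ) 2) where
  p A := T.pathProj A
  s a := (T.pathShift a).toOperator
  isStarProjection_p A := by
    refine ⟨?_, ?_⟩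
    · ext f x
      simp only [mul_apply_eq_comp, pathProj_apply]
      split_ifs <;> rfl
    · change star (PartialEquiv.toOperator _) = _
      rw [PartialEquiv.star_toOperator]
      rfl
  partialIsometry_s a := by
    ext f x
    rw [PartialEquiv.star_toOperator]
    simp only [mul_apply_eq_comp, PartialEquiv.toOperator_apply]
    by_cases hx : x ∈ (T.pathShift a).source
    · simp [hx]
    · simp [hx]
  p_empty := by
    ext f x
    simp [pathProj_apply]
  p_inter A A' := by
    ext f x
    simp only [mul_apply_eq_comp, pathProj_apply, Set.mem_inter_iff]
    split_ifs <;> simp_all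
  p_union A A' := by
    ext f x
    simp only [sub_apply, add_apply, lp.coeFn_sub,
      lp.coeFn_add, Pi.sub_apply, Pi.add_apply, pathProj_apply, Set.mem_inter_iff, Set.mem_union]
    by_cases h : x.1 ∈ (A : Set V) <;> by_cases h' : x.1 ∈ (A' : Set V) <;> simp [h, h']
  p_mul_s A a := by
    ext f x
    simp only [mul_apply_eq_comp, pathProj_apply, PartialEquiv.toOperator_apply]
    by_cases hx : x ∈ (T.pathShift a).source
    · have := T.pathShift_mem_relRange hx A
      split_ifs <;> simp_all
    · simp [hx]
  star_s_mul_s a := by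
    ext f x
    rw [PartialEquiv.star_toOperator]
    simp only [mul_apply_eq_comp, pathProj_apply, PartialEquiv.toOperator_apply]
    have h : x ∈ (T.pathShift a).target ↔ x.1 ∈ T.dyckGraph.range [a] := by
      rw [T.pathShift_target]; rfl
    by_cases hx : x ∈ (T.pathShift a).target
    · simp [hx, h.1 hx]
    · rw [if_neg fun h' => hx (h.2 h')]
      simp [hx]
  star_s_mul_s_of_ne a b hab := by
    ext f x
    rw [PartialEquiv.star_toOperator]
    simp only [mul_apply_eq_comp, PartialEquiv.toOperator_apply]
    by_cases hx : x ∈ (T.pathShift a).target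
    · have h1 := (T.pathShift a).map_target hx
      have h2 : (T.pathShift a).symm x ∉ (T.pathShift b).source := fun h2 =>
        hab ((T.existsUnique_mem_pathShift_source _).unique h1 h2)
      rw [if_neg h2, ite_self]
      rfl
    · simp [hx]
  p_eq_sum A hA := by
    ext f x
    obtain ⟨a, ha, hau⟩ := T.existsUnique_mem_pathShift_source x
    have hsum : ∀ F : Finset (DyckLetter N), ∀ g : DyckLetter N →
        (lp (fun _ : T.DyckPath => ℂ) 2 →L[ℂ] lp (fun _ : T.DyckPath => ℂ) 2),
        (∑ a ∈ F, g a) f x = ∑ a ∈ F, g a f x := by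
      intro F g
      rw [sum_apply, lp.coeFn_sum, Finset.sum_apply]
    rw [hsum, Finset.sum_eq_single a]
    · rw [PartialEquiv.star_toOperator]
      simp only [mul_apply_eq_comp, pathProj_apply, PartialEquiv.toOperator_apply]
      have := T.pathShift_mem_relRange ha A
      split_ifs <;> simp_all
    · intro b _ hb
      have : x ∉ (T.pathShift b).source := fun h => hb (hau b h)
      simp [PartialEquiv.toOperator_apply, this]
    · intro h
      have h1 := relRange_eq_empty_of_notMem_emitted T.dyckGraph (A := A) (a := a) (by simpa using h)
      simp [pathProj_apply, PartialEquiv.toOperator_apply, h1]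

theorem nontrivial_cstar (hN : 1 ≤ N) : Nontrivial T.dyckGraph.CStar := by
  classical
  refine ⟨T.dyckGraph.genP ⟨Set.univ, T.univ_mem hN⟩, 0, fun h => ?_⟩
  have h1 : T.pathProj Set.univ = 0 := by
    have := congrArg (T.dyckGraph.evalRep ⟨_, T.pathRepresentation⟩) h
    rw [map_zero] at this
    exact this
  obtain ⟨y⟩ := T.isTree.connected.nonempty
  have h2 := congrArg (fun g => g (lp.single 2 (y, fun _ => none) 1) (y, fun _ => none)) h1
  simp [pathProj_apply] at h2

end NaryTree

/-- For every `N ≥ 1`, the C*-algebra of the labelled graph presenting the Dyck shift `D_N` that is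
built from an `N`-ary tree is simple and purely infinite. -/
theorem proposition7p2 (N : ℕ) (hN : 1 ≤ N) {V : Type u} (T : NaryTree N V) :
    IsSimpleCStar T.dyckGraph.CStar ∧ IsPurelyInfiniteCStar T.dyckGraph.CStar := by
  have := T.nontrivial_cstar hN
  exact T.isSimpleCStar_and_isPurelyInfiniteCStar_cstar hN
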